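/- Let $K$ be a field and let $X$ be an $n\times n$ matrix over $K$. Decompose $K^n$ (row vectors, with matrices acting on the right) as a direct sum $\bigoplus_i U_i$ of $X$-invariant subspaces on each of which the action of $X$ is indecomposable. For each $i$ the minimal polynomial of the restriction $X|_{U_i}$ is $f_i^{t_i}$ for some monic irreducible $f_i\in K[x]$ and some integer $t_i\ge 1$. For a monic irreducible polynomial $f\in K[x]$, let $\lambda_f(X)$ be the partition whose parts, counted with multiplicity, are the $t_i$ with $f_i=f$; it does not depend on the chosen decomposition. Let $\Phi_X$ be the finite set of monic irreducible $f$ for which $\lambda_f(X)$ is non-empty. Monic irreducible polynomials $f,g\in K[x]$ are called equivalent, $f\sim g$, if in a splitting field $L$ of $fg$ over $K$ the following holds: for every root $\alpha\in L$ of $f$ there is a root $\beta\in L$ of $g$ with $K(\alpha)=K(\beta)$, and for every root $\beta\in L$ of $g$ there is a root $\alpha\in L$ of $f$ with $K(\alpha)=K(\beta)$. This is an equivalence relation; write $[f]$ for the class of $f$. The generalized type of $X$ is the formal product $\prod_{f\in\Phi_X}[f]^{\lambda_f(X)}$ in which the order of the factors is unimportant, that is, the multiset of pairs $([f],\lambda_f(X))$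 for $f\in\Phi_X$. **Theorem 1.1.** Let $K$ be a field and let $X,Y\in\mathrm{Mat}_n(K)$. The centralizers of $X$ and $Y$ in $\mathrm{Mat}_n(K)$ are conjugate by an element of $\mathrm{GL}_n(K)$ if and only if $X$ and $Y$ have the same generalized type. -/

import Mathlib

noncomputable section

open Polynomial IntermediateField
open scoped Matrix

namespace GenType

universe u

section Equivalence

variable {K : Type u} [Field K]

/-- Over an extension `L` of `K`: each root of `f` in `L` generates the same subextension
`K(α) = K(β)` of `L` as some root of `g`, and vice versa. -/
def RootsMatch (L : Type*) [Field L] [Algebra K L] (f g : K[X]) : Prop :=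
  (∀ α : L, aeval α f = 0 → ∃ β : L, aeval β g = 0 ∧ K⟮α⟯ = K⟮β⟯) ∧
  (∀ β : L, aeval β g = 0 → ∃ α : L, aeval α f = 0 ∧ K⟮α⟯ = K⟮β⟯)

/-- Equivalence of polynomials: the matching of roots takes place in a splitting field of `f * g`. -/
def PolyEquiv (f g : K[X]) : Prop :=
  RootsMatch (f * g).SplittingField f g

/-- The irreducible polynomials over `K`, normalised to be monic. -/
def MonicIrred (K : Type u) [Field K] : Type u :=
  {f : K[X] // Irreducible f ∧ f.Monic}

theorem exists_preimage_root {L Ω : Type*} [Field L] [Algebra K L] [Field Ω] [Algebra K Ω]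
    (φ : L →ₐ[K] Ω) {f : K[X]} (hf : f ≠ 0) (hs : (f.map (algebraMap K L)).Splits)
    {ω : Ω} (hω : aeval ω f = 0) : ∃ α : L, aeval α f = 0 ∧ φ α = ω := by
  have h1 : (f.aroots Ω) = (f.aroots L).map φ := by
    have := hs.roots_map (φ : L →+* Ω)
    rw [Polynomial.map_map, AlgHom.comp_algebraMap] at this
    exact this
  have h2 : ω ∈ f.aroots Ω := by
    rw [mem_aroots]; exact ⟨hf, hω⟩
  rw [h1, Multiset.mem_map] at h2
  obtain ⟨α, hα, rfl⟩ := h2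
  exact ⟨α, (mem_aroots.1 hα).2, rfl⟩

theorem adjoin_eq_iff {L Ω : Type*} [Field L] [Algebra K L] [Field Ω] [Algebra K Ω]
    (φ : L →ₐ[K] Ω) (α β : L) : K⟮φ α⟯ = K⟮φ β⟯ ↔ K⟮α⟯ = K⟮β⟯ := by
  have h : ∀ a : L, K⟮φ a⟯ = K⟮a⟯.map φ := fun a => by
    rw [IntermediateField.adjoin_map, Set.image_singleton]
  rw [h, h]
  exact (IntermediateField.map_injective φ).eq_iff

theorem rootsMatch_iff {L Ω : Type*} [Field L] [Algebra K L] [Field Ω] [Algebra K Ω]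
    (φ : L →ₐ[K] Ω) {f g : K[X]} (hf : f ≠ 0) (hg : g ≠ 0)
    (hfs : (f.map (algebraMap K L)).Splits) (hgs : (g.map (algebraMap K L)).Splits) :
    RootsMatch L f g ↔ RootsMatch Ω f g := by
  have key : ∀ (h : K[X]) (a : L), aeval (φ a) h = 0 ↔ aeval a h = 0 := fun h a => by
    rw [aeval_algHom_apply, map_eq_zero_iff φ φ.injective]
  constructor
  · rintro ⟨h1, h2⟩
    constructor
    · intro ω hω
      obtain ⟨α, hα, rfl⟩ := exists_preimage_root φ hf hfs hω
      obtain ⟨β, hβ, e⟩ := h1 α hα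
      exact ⟨φ β, (key _ _).2 hβ, (adjoin_eq_iff φ α β).2 e⟩
    · intro ω hω
      obtain ⟨β, hβ, rfl⟩ := exists_preimage_root φ hg hgs hω
      obtain ⟨α, hα, e⟩ := h2 β hβ
      exact ⟨φ α, (key _ _).2 hα, (adjoin_eq_iff φ α β).2 e⟩
  · rintro ⟨h1, h2⟩
    constructor
    · intro α hα
      obtain ⟨ω, hω, e⟩ := h1 (φ α) ((key _ _).2 hα)
      obtain ⟨β, hβ, rfl⟩ := exists_preimage_root φ hg hgs hω
      exact ⟨β, hβ, (adjoin_eq_iff φ α β).1 e⟩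
    · intro β hβ
      obtain ⟨ω, hω, e⟩ := h2 (φ β) ((key _ _).2 hβ)
      obtain ⟨α, hα, rfl⟩ := exists_preimage_root φ hf hfs hω
      exact ⟨α, hα, (adjoin_eq_iff φ α β).1 e⟩

theorem polyEquiv_iff {f g : K[X]} (hf : f ≠ 0) (hg : g ≠ 0) :
    PolyEquiv f g ↔ RootsMatch (AlgebraicClosure K) f g := by
  have h := SplittingField.splits (f * g)
  rw [Polynomial.map_mul] at h
  have hne : f.map (algebraMap K (f * g).SplittingField) *
      g.map (algebraMap K (f * g).SplittingField) ≠ 0 :=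
    mul_ne_zero (Polynomial.map_ne_zero hf) (Polynomial.map_ne_zero hg)
  exact rootsMatch_iff (IsAlgClosed.lift : (f * g).SplittingField →ₐ[K] AlgebraicClosure K) hf hg
    (h.of_dvd hne (dvd_mul_right _ _)) (h.of_dvd hne (dvd_mul_left _ _))

theorem rootsMatch_equivalence (Ω : Type*) [Field Ω] [Algebra K Ω] :
    Equivalence (RootsMatch (K := K) Ω) where
  refl f := ⟨fun α h => ⟨α, h, rfl⟩, fun α h => ⟨α, h, rfl⟩⟩
  symm := fun ⟨h1, h2⟩ =>
    ⟨fun β hβ => (h2 β hβ).imp fun _ h => ⟨h.1, h.2.symm⟩,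
      fun α hα => (h1 α hα).imp fun _ h => ⟨h.1, h.2.symm⟩⟩
  trans := fun ⟨h1, h2⟩ ⟨k1, k2⟩ => by
    constructor
    · intro α hα
      obtain ⟨β, hβ, e⟩ := h1 α hα
      obtain ⟨γ, hγ, e'⟩ := k1 β hβ
      exact ⟨γ, hγ, e.trans e'⟩
    · intro γ hγ
      obtain ⟨β, hβ, e⟩ := k2 γ hγ
      obtain ⟨α, hα, e'⟩ := h2 β hβ
      exact ⟨α, hα, e'.trans e⟩

/-- The equivalence relation `f ∼ g` on monic irreducible polynomials. -/
def irredSetoid (K : Type u) [Field K] : Setoid (MonicIrred K) where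
  r f g := PolyEquiv f.1 g.1
  iseqv := by
    have h : ∀ f g : MonicIrred K,
        PolyEquiv f.1 g.1 ↔ RootsMatch (AlgebraicClosure K) f.1 g.1 :=
      fun f g => polyEquiv_iff f.2.1.ne_zero g.2.1.ne_zero
    have E := rootsMatch_equivalence (K := K) (AlgebraicClosure K)
    exact
      { refl := fun f => (h f f).2 (E.refl _)
        symm := fun {f g} a => (h g f).2 (E.symm ((h f g).1 a))
        trans := fun {f g k} a b => (h f k).2 (E.trans ((h f g).1 a) ((h g k).1 b)) }

end Equivalence

section Decomposition

variable {K : Type u} [Field K] {V : Type*} [AddCommGroup V] [Module K V]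

/-- `U` is mapped into itself by `T`. -/
def Invariant (T : Module.End K V) (U : Submodule K V) : Prop :=
  ∀ v ∈ U, T v ∈ U

/-- The action of `T` on the (invariant) subspace `U` is indecomposable: `U` is nonzero and is
not the direct sum of two nonzero invariant subspaces. -/
def Indecomposable (T : Module.End K V) (U : Submodule K V) : Prop :=
  U ≠ ⊥ ∧ ∀ A B : Submodule K V, Invariant T A → Invariant T B →
    A ⊓ B = ⊥ → A ⊔ B = U → A = ⊥ ∨ B = ⊥

/-- A decomposition of `V` as an internal direct sum of `T`-invariant subspaces `space i` on each
of which `T` acts indecomposably, together with the monic irreducible polynomial `poly i` and the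
positive integer `exp i` such that the restriction of `T` to `space i` has minimal polynomial
`(poly i) ^ (exp i)`. -/
structure IndecDecomp (T : Module.End K V) where
  size : ℕ
  space : Fin size → Submodule K V
  internal : DirectSum.IsInternal space
  invariant : ∀ i, Invariant T (space i)
  indecomposable : ∀ i, Indecomposable T (space i)
  poly : Fin size → MonicIrred K
  exp : Fin size → ℕ
  exp_pos : ∀ i, 0 < exp i
  minpoly_eq : ∀ i, minpoly K (T.restrict (invariant i)) = (poly i).1 ^ exp i

theorem invariant_aeval {T : Module.End K V} {U : Submodule K V} (hU : Invariant T U) (p : K[X]) :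
    Invariant T (U ⊓ LinearMap.ker (aeval T p)) := by
  rintro v ⟨h1, h2⟩
  refine ⟨hU v h1, ?_⟩
  have hc : aeval T p * T = T * aeval T p := by
    have := congrArg (aeval T) (mul_comm p X)
    simpa using this
  have := LinearMap.congr_fun hc v
  simp only [SetLike.mem_coe, LinearMap.mem_ker] at h2 ⊢
  simpa [h2] using this

theorem aeval_restrict_coe {T : Module.End K V} {U : Submodule K V} (hU : Invariant T U)
    (p : K[X]) (v : U) : ((aeval (T.restrict hU) p v : U) : V) = aeval T p v := by
  induction p using Polynomial.induction_on' with
  | add p q hp hq => simp [hp, hq]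
  | monomial k a =>
    have : ∀ k : ℕ, (((T.restrict hU) ^ k) v : V) = (T ^ k) v := by
      intro k
      induction k with
      | zero => simp
      | succ k ih => rw [pow_succ', pow_succ']; rw [Module.End.mul_apply, Module.End.mul_apply, ← ih]; rfl
    simp [aeval_monomial, this]

/-- On an indecomposable invariant subspace the minimal polynomial is a power of an
irreducible polynomial. -/
theorem exists_minpoly_eq [FiniteDimensional K V] {T : Module.End K V} {U : Submodule K V}
    (hU : Invariant T U) (hi : Indecomposable T U) :
    ∃ (f : MonicIrred K) (t : ℕ), 0 < t ∧ minpoly K (T.restrict hU) = f.1 ^ t := by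
  classical
  set S := T.restrict hU with hS
  have hint : IsIntegral K S := Algebra.IsIntegral.isIntegral S
  have hm := minpoly.monic hint
  have : Nontrivial U := Submodule.nontrivial_iff_ne_bot.2 hi.1
  have hnu : ¬ IsUnit (minpoly K S) := minpoly.not_isUnit K S
  obtain ⟨f, hfm, hfi, hfd⟩ := Polynomial.exists_monic_irreducible_factor _ hnu
  obtain ⟨c, e, hc⟩ :=
    (FiniteMultiplicity.of_not_isUnit hfi.not_isUnit hm.ne_zero).exists_eq_pow_mul_and_not_dvd
  set t := multiplicity f (minpoly K S)
  have ht : 0 < t := by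
    rcases Nat.eq_zero_or_pos t with h | h
    · rw [h, pow_zero, one_mul] at e; exact absurd (by rwa [← e]) hc
    · exact h
  have hcm : c.Monic := (hfm.pow t).of_mul_monic_left (e ▸ hm)
  have hcop : IsCoprime (f ^ t) c := (hfi.coprime_iff_not_dvd.2 hc).pow_left
  have hkill : ∀ v ∈ U, aeval T (f ^ t * c) v = 0 := fun v hv => by
    have h := aeval_restrict_coe hU (minpoly K S) ⟨v, hv⟩
    rw [minpoly.aeval] at h
    rw [← e]; exact h.symm
  have hfull : ∀ p : K[X], U ≤ LinearMap.ker (aeval T p) → minpoly K S ∣ p := fun p hp => by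
    apply minpoly.dvd
    ext v
    rw [aeval_restrict_coe hU p v]
    simpa using hp v.2
  refine ⟨⟨f, hfi, hfm⟩, t, ht, ?_⟩
  obtain ⟨a, b, hab⟩ := hcop
  have hsplit : ∀ v : V, aeval T (a * f ^ t) v + aeval T (b * c) v = v := fun v => by
    rw [← LinearMap.add_apply, ← map_add, hab, map_one]; rfl
  have hinvp : ∀ (p : K[X]), ∀ v ∈ U, aeval T p v ∈ U := fun p v hv => by
    rw [← aeval_restrict_coe hU p ⟨v, hv⟩]; exact Subtype.prop _
  have hmulz : ∀ (p q : K[X]) (v : V), aeval T q v = 0 → aeval T (p * q) v = 0 :=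
    fun p q v h => by rw [map_mul, Module.End.mul_apply, h, map_zero]
  have hU' : (U ⊓ LinearMap.ker (aeval T (f ^ t))) ⊔ (U ⊓ LinearMap.ker (aeval T c)) = U := by
    apply le_antisymm (sup_le inf_le_left inf_le_left)
    intro v hv
    rw [Submodule.mem_sup]
    refine ⟨aeval T (b * c) v, ⟨hinvp _ v hv, ?_⟩, aeval T (a * f ^ t) v,
      ⟨hinvp _ v hv, ?_⟩, by rw [add_comm, hsplit]⟩
    · change aeval T (f ^ t) (aeval T (b * c) v) = 0
      rw [← Module.End.mul_apply, ← map_mul,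
        show f ^ t * (b * c) = b * (f ^ t * c) by ring]
      exact hmulz _ _ _ (hkill v hv)
    · change aeval T c (aeval T (a * f ^ t) v) = 0
      rw [← Module.End.mul_apply, ← map_mul,
        show c * (a * f ^ t) = a * (f ^ t * c) by ring]
      exact hmulz _ _ _ (hkill v hv)
  have hdec := hi.2 (U ⊓ LinearMap.ker (aeval T (f ^ t))) (U ⊓ LinearMap.ker (aeval T c))
    (invariant_aeval hU _) (invariant_aeval hU _)
    (by
      rw [eq_bot_iff]
      rintro v ⟨⟨_, h1⟩, ⟨_, h2⟩⟩
      rw [Submodule.mem_bot, ← hsplit v, hmulz _ _ _ h1, hmulz _ _ _ h2, add_zero])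
    hU'
  rcases hdec with h | h
  · rw [h, bot_sup_eq] at hU'
    have h1 := hfull c (by rw [← hU']; exact inf_le_right)
    exact absurd ((dvd_pow_self f ht.ne').trans ((Dvd.intro _ e.symm).trans h1)) hc
  · rw [h, sup_bot_eq] at hU'
    have h1 := hfull (f ^ t) (by rw [← hU']; exact inf_le_right)
    exact eq_of_monic_of_associated hm (hfm.pow t)
      (associated_of_dvd_dvd h1 (Dvd.intro _ e.symm))

/-- Every invariant subspace is a finite direct sum of indecomposable invariant subspaces. -/
theorem exists_indec_finset [FiniteDimensional K V] (T : Module.End K V) (d : ℕ) :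
    ∀ U : Submodule K V, Invariant T U → Module.finrank K U = d →
      ∃ s : Finset (Submodule K V), (∀ A ∈ s, Invariant T A ∧ Indecomposable T A) ∧
        s.SupIndep id ∧ s.sup id = U := by
  classical
  induction d using Nat.strong_induction_on with
  | _ d ih =>
    intro U hU hd
    by_cases hb : U = ⊥
    · exact ⟨∅, by simp, by simp, by simp [hb]⟩
    by_cases hi : Indecomposable T U
    · exact ⟨{U}, by simp [hU, hi], by simp, by simp⟩
    · simp only [Indecomposable, not_and, not_forall, not_or] at hi
      obtain ⟨A, B, hA, hB, hAB, hs, hA0, hB0⟩ := hi hb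
      have hdim := Submodule.finrank_sup_add_finrank_inf_eq A B
      rw [hs, hAB, finrank_bot, hd] at hdim
      have pA : 0 < Module.finrank K A := by
        rw [pos_iff_ne_zero]; exact fun h => hA0 (Submodule.finrank_eq_zero.1 h)
      have pB : 0 < Module.finrank K B := by
        rw [pos_iff_ne_zero]; exact fun h => hB0 (Submodule.finrank_eq_zero.1 h)
      obtain ⟨s, s1, s2, s3⟩ := ih _ (by omega) A hA rfl
      obtain ⟨r, r1, r2, r3⟩ := ih _ (by omega) B hB rfl
      refine ⟨s ∪ r, ?_, ?_, ?_⟩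
      · intro C hC
        rcases Finset.mem_union.1 hC with h | h
        exacts [s1 C h, r1 C h]
      · have hd' : Disjoint (s.sup id) (r.sup id) := by
          rw [s3, r3, disjoint_iff]; exact hAB
        exact s2.union r2 hd'
      · rw [Finset.sup_union, s3, r3, hs]

theorem nonempty_indecDecomp [FiniteDimensional K V] (T : Module.End K V) :
    Nonempty (IndecDecomp T) := by
  classical
  obtain ⟨s, s1, s2, s3⟩ := exists_indec_finset T _ ⊤ (fun _ _ => Submodule.mem_top) rfl
  let e := s.equivFin.symm
  have hinv : ∀ i, Invariant T (e i).1 := fun i => (s1 _ (e i).2).1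
  have hind : ∀ i, Indecomposable T (e i).1 := fun i => (s1 _ (e i).2).2
  choose f t ht hm using fun i => exists_minpoly_eq (hinv i) (hind i)
  refine ⟨⟨s.card, fun i => (e i).1, ?_, hinv, hind, f, t, ht, hm⟩⟩
  rw [DirectSum.isInternal_submodule_iff_iSupIndep_and_iSup_eq_top]
  constructor
  · have h : iSupIndep (fun x : s => (x : Submodule K V)) := s2.independent
    exact h.comp e.injective
  · rw [Equiv.iSup_comp (g := fun x : s => (x : Submodule K V)) e, ← s3, Finset.sup_id_eq_sSup,
      sSup_eq_iSup']
    rfl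

end Decomposition

section Matrices

variable {K : Type u} [Field K] {n : ℕ}

/-- A decomposition of `K ^ n` (row vectors, with matrices acting on the right) into
indecomposable `X`-invariant subspaces. -/
def decomp (X : Matrix (Fin n) (Fin n) K) : IndecDecomp X.vecMulLinear :=
  Classical.choice (nonempty_indecDecomp _)

open scoped Classical in
/-- The partition invariant `λ_f` of `X`: the exponents `t` of those indecomposable summands on
which `X` has minimal polynomial `f ^ t`, counted with multiplicity.  A partition is recorded as
the multiset of its (positive) parts; it does not depend on the decomposition. -/
def partitionInvariant (X : Matrix (Fin n) (Fin n) K) (f : MonicIrred K) : Multiset ℕ :=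
  (Finset.univ.filter fun i => (decomp X).poly i = f).val.map (decomp X).exp

/-- The set of monic irreducible polynomials whose partition invariant in `X` is non-empty. -/
def support (X : Matrix (Fin n) (Fin n) K) : Set (MonicIrred K) :=
  {f | partitionInvariant X f ≠ 0}

theorem support_finite (X : Matrix (Fin n) (Fin n) K) : (support X).Finite := by
  classical
  refine (Set.finite_range (decomp X).poly).subset fun f hf => ?_
  by_contra h
  apply hf
  rw [partitionInvariant, Multiset.map_eq_zero, Finset.val_eq_zero, Finset.filter_eq_empty_iff]
  exact fun i _ hi => h ⟨i, hi⟩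

/-- The generalized type of `X`: the formal product, with unimportant order, of the symbols
`[f] ^ λ_f` over the polynomials `f` in the support, that is, the multiset of the
pairs `([f], λ_f)`. -/
def generalizedType (X : Matrix (Fin n) (Fin n) K) :
    Multiset (Quotient (irredSetoid K) × Multiset ℕ) :=
  (support_finite X).toFinset.val.map fun f =>
    (Quotient.mk (irredSetoid K) f, partitionInvariant X f)

end Matrices

end GenType

end

/-! Let `T` and `S` be the row actions of `X` and `Y`. On an indecomposable summand `T` is cyclic
with annihilator generated by `f ^ t` (`exists_generator`), so questions about `T` become questions
of divisibility in `K[X]`.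

Suppose the centralizers are conjugate; after transport they coincide. The projection attached to an
invariant splitting for `T` lies in the centralizer, so `T` and `S` have the same complemented
invariant subspaces, hence the same indecomposable decompositions (`exists_same_space`). As `T` and
`S` commute, on a summand cyclic for both each is a polynomial in the other. These polynomials match
roots generating the same field, and dimensions give equal exponents (`polyEquiv_of_generators`).
Two summands share their irreducible polynomial exactly when the centralizer moves some vector of
one to a nonzero vector of the other (`poly_eq_of_poly_eq`). The ranks of the `f(T) ^ k` make the
partitions independent of the decomposition (`parts_eq`).

Conversely, equal types give a matching of summands. If `f ∼ g`, some `b` makes `f` divide `g(b)`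
exactly once (`exists_comp_dvd_not_sq_dvd`). The Chinese remainder theorem merges these into one
`p`, and `p(T)` is similar to `S` (`exists_aeval_conj`). So the centralizer of `T` is conjugate into
that of `S`; by symmetry the reverse holds too, and finite dimension forces equality
(`commute_conj_iff`). -/

noncomputable section

open Polynomial IntermediateField

namespace GenType

universe u

/-! ### Cyclic subspaces and the cyclicity of indecomposable summands. -/

section Orbit

variable {K : Type u} [Field K] {V : Type*} [AddCommGroup V] [Module K V]
  {W : Type*} [AddCommGroup W] [Module K W]

/-- The linear map `p ↦ p(T) v`. -/
def orbitMap (T : Module.End K V) (v : V) : K[X] →ₗ[K] V :=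
  (LinearMap.applyₗ v) ∘ₗ (aeval T).toLinearMap

@[simp]
theorem orbitMap_apply (T : Module.End K V) (v : V) (p : K[X]) :
    orbitMap T v p = aeval T p v := rfl

theorem aeval_mul_apply (T : Module.End K V) (p q : K[X]) (v : V) :
    aeval T (p * q) v = aeval T p (aeval T q v) := by
  rw [map_mul, Module.End.mul_apply]

theorem aeval_comp_apply (T : Module.End K V) (p q : K[X]) (v : V) :
    aeval T (p.comp q) v = aeval (aeval T q) p v := by
  rw [aeval_comp]

theorem aeval_comm_apply (T : Module.End K V) (p q : K[X]) (v : V) :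
    aeval T p (aeval T q v) = aeval T q (aeval T p v) := by
  rw [← aeval_mul_apply, mul_comm, aeval_mul_apply]

/-- A linear map intertwining `T` and `S` on an invariant subspace intertwines `p(T)` and
`p(S)` there. -/
theorem aeval_intertwine {T : Module.End K V} {S : Module.End K W} {U : Submodule K V}
    (hU : Invariant T U) (φ : V →ₗ[K] W) (h : ∀ u ∈ U, φ (T u) = S (φ u)) (p : K[X]) :
    ∀ u ∈ U, aeval T p u ∈ U ∧ φ (aeval T p u) = aeval S p (φ u) := by
  induction p using Polynomial.induction_on with
  | C a => intro u hu; simpa using U.smul_mem a hu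
  | add p q hp hq =>
    intro u hu
    simp [U.add_mem (hp u hu).1 (hq u hu).1, (hp u hu).2, (hq u hu).2]
  | monomial n a ih =>
    intro u hu
    rw [pow_succ, ← mul_assoc, aeval_mul_apply, aeval_mul_apply S, aeval_X, aeval_X, ← h u hu]
    exact ih _ (hU u hu)

theorem Invariant.aeval_mem {T : Module.End K V} {U : Submodule K V} (hU : Invariant T U)
    (p : K[X]) {u : V} (hu : u ∈ U) : aeval T p u ∈ U :=
  (aeval_intertwine (S := T) hU LinearMap.id (fun _ _ => rfl) p u hu).1

theorem aeval_eq_of_eqOn {T S : Module.End K V} {U : Submodule K V} (hU : Invariant T U)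
    (h : ∀ u ∈ U, T u = S u) (p : K[X]) {u : V} (hu : u ∈ U) : aeval T p u = aeval S p u :=
  (aeval_intertwine hU LinearMap.id h p u hu).2

/-- An orbit map with annihilator `m` has range of dimension `natDegree m`. -/
theorem finrank_range_orbitMap {T : Module.End K V} {v : V} {m : K[X]}
    (h : ∀ q, aeval T q v = 0 ↔ m ∣ q) :
    Module.finrank K (LinearMap.range (orbitMap T v)) = m.natDegree := by
  have hk : LinearMap.ker (orbitMap T v) = (Ideal.span {m}).restrictScalars K := by
    ext q
    rw [LinearMap.mem_ker, orbitMap_apply, h, Submodule.restrictScalars_mem,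
      Ideal.mem_span_singleton]
  rw [← (orbitMap T v).quotKerEquivRange.finrank_eq, hk, ← finrank_quotient_span_eq_natDegree]
  rfl

/-- If `b` is killed by whatever kills `a`, there is a map of orbits taking `a` to `b`. -/
theorem exists_orbit_hom {T : Module.End K V} {S : Module.End K W} {v : V} {w : W}
    (h : ∀ q : K[X], aeval T q v = 0 → aeval S q w = 0) :
    ∃ φ : LinearMap.range (orbitMap T v) →ₗ[K] W,
      ∀ (q : K[X]) (hq : aeval T q v ∈ LinearMap.range (orbitMap T v)),
        φ ⟨aeval T q v, hq⟩ = aeval S q w := by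
  refine ⟨((LinearMap.ker (orbitMap T v)).liftQ (orbitMap S w) fun q hq => h q hq) ∘ₗ
    (orbitMap T v).quotKerEquivRange.symm.toLinearMap, fun q hq => ?_⟩
  have : (orbitMap T v).quotKerEquivRange.symm ⟨aeval T q v, hq⟩ = Submodule.Quotient.mk q := by
    rw [LinearEquiv.symm_apply_eq]; rfl
  rw [LinearMap.comp_apply, LinearEquiv.coe_coe, this]
  rfl

/-- Both orbits are the quotient of `K[X]` by the same annihilator. -/
theorem exists_orbit_equiv {T : Module.End K V} {S : Module.End K W} {v : V} {w : W}
    (h : ∀ q : K[X], aeval T q v = 0 ↔ aeval S q w = 0) :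
    ∃ φ : LinearMap.range (orbitMap T v) ≃ₗ[K] LinearMap.range (orbitMap S w),
      ∀ (q : K[X]) (hq : aeval T q v ∈ LinearMap.range (orbitMap T v)),
        (φ ⟨aeval T q v, hq⟩ : W) = aeval S q w := by
  have hk : LinearMap.ker (orbitMap T v) = LinearMap.ker (orbitMap S w) := by
    ext q; exact h q
  refine ⟨(orbitMap T v).quotKerEquivRange.symm ≪≫ₗ Submodule.quotEquivOfEq _ _ hk ≪≫ₗ
    (orbitMap S w).quotKerEquivRange, fun q hq => ?_⟩
  have : (orbitMap T v).quotKerEquivRange.symm ⟨aeval T q v, hq⟩ = Submodule.Quotient.mk q := by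
    rw [LinearEquiv.symm_apply_eq]; rfl
  simp [this]

/-- A finitely generated torsion module over a principal ideal domain, killed by a power of a
prime and not the sum of two proper complementary submodules, is cyclic. -/
theorem exists_span_singleton_eq_top {R M : Type*} [CommRing R] [IsDomain R]
    [IsPrincipalIdealRing R] [AddCommGroup M] [Module R M] [Module.Finite R M] [Nontrivial M]
    {p : R} (hp : Irreducible p) (hM : Module.IsTorsion' M (Submonoid.powers p))
    (hi : ∀ A B : Submodule R M, A ⊓ B = ⊥ → A ⊔ B = ⊤ → A = ⊥ ∨ B = ⊥) :
    ∃ v : M, Submodule.span R {v} = ⊤ := by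
  classical
  obtain ⟨d, k, ⟨e⟩⟩ := Module.torsion_by_prime_power_decomposition hp hM
  obtain ⟨m, hm⟩ := exists_ne (0 : M)
  have hne : e m ≠ 0 := by simpa using hm
  -- Factors with `k i = 0` vanish, so the index must be one at which a nonzero vector has a nonzero
  -- component. This factor splits off, hence is everything.
  obtain ⟨i, hi0⟩ : ∃ i, e m i ≠ 0 := by
    by_contra! hc
    exact hne (DFinsupp.ext hc)
  let a := DirectSum.lof R (Fin d) (fun i => R ⧸ Submodule.span R {p ^ k i}) i
  let c := DirectSum.component R (Fin d) (fun i => R ⧸ Submodule.span R {p ^ k i}) i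
  have hca : ∀ x, c (a x) = x := fun x => DirectSum.component.lof_self (R := R)
    (M := fun i => R ⧸ Submodule.span R {p ^ k i}) i x
  let α := e.symm.toLinearMap ∘ₗ a
  let γ := c ∘ₗ e.toLinearMap
  have hγα : ∀ x, γ (α x) = x := fun x => by simp [α, γ, hca]
  have hcompl : LinearMap.range α ⊓ LinearMap.ker γ = ⊥ := by
    rw [eq_bot_iff]
    rintro _ ⟨⟨x, rfl⟩, hx⟩
    have : x = 0 := by rw [← hγα x]; exact hx
    simp [this]
  have hsup : LinearMap.range α ⊔ LinearMap.ker γ = ⊤ := by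
    rw [eq_top_iff]
    intro x _
    rw [Submodule.mem_sup]
    exact ⟨α (γ x), ⟨_, rfl⟩, x - α (γ x), by simp [hγα], by abel⟩
  rcases hi _ _ hcompl hsup with h | h
  · exfalso
    have h0 : α (γ m) = 0 := by
      rw [← Submodule.mem_bot R, ← h]; exact ⟨_, rfl⟩
    have := hγα (γ m)
    rw [h0, map_zero] at this
    exact hi0 this.symm
  · rw [h, sup_bot_eq] at hsup
    refine ⟨α (Submodule.Quotient.mk 1), ?_⟩
    rw [eq_top_iff, ← hsup]
    rintro _ ⟨x, rfl⟩
    obtain ⟨r, rfl⟩ := Submodule.Quotient.mk_surjective _ x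
    rw [Submodule.mem_span_singleton]
    exact ⟨r, by rw [← map_smul, ← Submodule.Quotient.mk_smul, smul_eq_mul, mul_one]⟩

/-- An indecomposable invariant subspace is cyclic. -/
theorem exists_generator [FiniteDimensional K V] {T : Module.End K V} {U : Submodule K V}
    (hU : Invariant T U) (hi : Indecomposable T U) {f : K[X]} (hf : Irreducible f) {t : ℕ}
    (hm : minpoly K (T.restrict hU) = f ^ t) :
    ∃ v, LinearMap.range (orbitMap T v) = U ∧ ∀ q, aeval T q v = 0 ↔ f ^ t ∣ q := by
  set S := T.restrict hU with hS
  let M := Module.AEval' S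
  let o := Module.AEval'.of S
  have hsm : ∀ (p : K[X]) (u : U), p • o u = o (aeval S p u) := fun p u => by
    exact Module.AEval.of_aeval_smul S p u |>.symm
  have : Nontrivial U := Submodule.nontrivial_iff_ne_bot.2 hi.1
  have : Nontrivial M := o.symm.toEquiv.nontrivial
  have hfin : Module.Finite K[X] M := inferInstance
  have htors : Module.IsTorsion' M (Submonoid.powers f) := by
    rintro x
    refine ⟨⟨f ^ t, t, rfl⟩, ?_⟩
    obtain ⟨u, rfl⟩ := o.surjective x
    change f ^ t • o u = 0
    rw [hsm, ← hm, minpoly.aeval]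
    simp
  -- `φ` turns `K[X]`-submodules into `T`-invariant subspaces of `U`, so indecomposability passes to
  -- the module `M`.
  let φ : Submodule K[X] M → Submodule K V := fun A =>
    ((A.restrictScalars K).comap o.toLinearMap).map U.subtype
  have hφ : ∀ A (u : U), (u : V) ∈ φ A ↔ o u ∈ A := by
    intro A u
    simp only [φ, Submodule.mem_map, Submodule.mem_comap, Submodule.coe_subtype]
    constructor
    · rintro ⟨y, hy, e⟩
      rw [← Subtype.ext e]; exact hy
    · exact fun h => ⟨u, h, rfl⟩
  have hφU : ∀ A, φ A ≤ U := fun A => Submodule.map_subtype_le _ _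
  have hinv : ∀ A, Invariant T (φ A) := by
    intro A v hv
    have hvU := hφU A hv
    have h1 := (hφ A ⟨v, hvU⟩).1 hv
    have h2 := A.smul_mem X h1
    rw [hsm, aeval_X] at h2
    exact (hφ A _).2 h2
  have hbot : ∀ A, φ A = ⊥ → A = ⊥ := by
    intro A h
    rw [eq_bot_iff]
    intro x hx
    obtain ⟨u, rfl⟩ := o.surjective x
    have := (hφ A u).2 hx
    rw [h, Submodule.mem_bot] at this
    have : u = 0 := Subtype.ext this
    simp [this]
  obtain ⟨x, hx⟩ := exists_span_singleton_eq_top hf htors (fun A B hAB hAB' => by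
    refine (hi.2 (φ A) (φ B) (hinv A) (hinv B) ?_ ?_).imp (hbot A) (hbot B)
    · rw [eq_bot_iff]
      rintro v ⟨h1, h2⟩
      have h1' := (hφ A ⟨v, hφU A h1⟩).1 h1
      have h2' := (hφ B ⟨v, hφU A h1⟩).1 h2
      have : o ⟨v, hφU A h1⟩ ∈ A ⊓ B := ⟨h1', h2'⟩
      rw [hAB, Submodule.mem_bot] at this
      have := o.map_eq_zero_iff.1 this
      exact congrArg Subtype.val this
    · apply le_antisymm (sup_le (hφU A) (hφU B))
      intro v hv
      have : o ⟨v, hv⟩ ∈ A ⊔ B := by rw [hAB']; trivial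
      obtain ⟨a, ha, b, hb, e⟩ := Submodule.mem_sup.1 this
      obtain ⟨a, rfl⟩ := o.surjective a
      obtain ⟨b, rfl⟩ := o.surjective b
      rw [← map_add] at e
      have e := congrArg Subtype.val (o.injective e)
      rw [Submodule.mem_sup]
      exact ⟨a, (hφ A a).2 ha, b, (hφ B b).2 hb, e⟩)
  obtain ⟨v, rfl⟩ := o.surjective x
  have hgen : ∀ u : U, ∃ p : K[X], aeval S p v = u := by
    intro u
    have : o u ∈ Submodule.span K[X] {o v} := by rw [hx]; trivial
    obtain ⟨p, hp⟩ := Submodule.mem_span_singleton.1 this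
    rw [hsm] at hp
    exact ⟨p, o.injective hp⟩
  refine ⟨v, ?_, fun q => ?_⟩
  · apply le_antisymm
    · rintro _ ⟨p, rfl⟩
      exact hU.aeval_mem p v.2
    · intro u hu
      obtain ⟨p, hp⟩ := hgen ⟨u, hu⟩
      exact ⟨p, by rw [orbitMap_apply, ← aeval_restrict_coe hU p v, hp]⟩
  · rw [← hm, ← aeval_restrict_coe hU q v]
    constructor
    · intro h
      apply minpoly.dvd
      ext u
      obtain ⟨p, rfl⟩ := hgen u
      have h' : aeval S q v = 0 := Subtype.ext h
      rw [aeval_comm_apply, h']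
      simp
    · rintro ⟨r, rfl⟩
      rw [mul_comm, aeval_mul_apply, minpoly.aeval]
      simp

theorem finrank_of_generator {T : Module.End K V} {U : Submodule K V} {v : V}
    {m : K[X]} (hv : LinearMap.range (orbitMap T v) = U) (h : ∀ q, aeval T q v = 0 ↔ m ∣ q) :
    Module.finrank K U = m.natDegree := by
  rw [← hv, finrank_range_orbitMap h]

end Orbit

/-! ### Equivalent irreducible polynomials and substitutions between them. -/

section Substitution

variable {K : Type u} [Field K]

/-- First order Taylor expansion of a composition. -/
theorem exists_comp_add (p x y : K[X]) :
    ∃ k, p.comp (x + y) = p.comp x + (derivative p).comp x * y + k * y ^ 2 := by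
  obtain ⟨k, hk⟩ := (p.map C).binomExpansion x y
  refine ⟨k, ?_⟩
  simpa [eval_map, comp, derivative_map] using hk

/-- An irreducible polynomial with root `α` is associated to `minpoly K α`. -/
theorem aeval_eq_zero_iff_dvd {L : Type*} [Field L] [Algebra K L] {f : K[X]}
    (hf : Irreducible f) {α : L} (hα : aeval α f = 0) (q : K[X]) :
    aeval α q = 0 ↔ f ∣ q := by
  have h1 : f ∣ minpoly K α := by
    have hd := minpoly.dvd K α hα
    obtain ⟨r, hr⟩ := hd
    rcases hf.isUnit_or_isUnit hr with h | h
    · exact absurd h (minpoly.not_isUnit K α)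
    · obtain ⟨s, rfl⟩ := h
      exact ⟨s⁻¹.1, by rw [hr, mul_assoc, Units.mul_inv, mul_one]⟩
  constructor
  · exact fun h => h1.trans (minpoly.dvd K α h)
  · rintro ⟨r, rfl⟩
    simp [hα]

theorem exists_aeval_eq_of_mem_adjoin {L : Type*} [Field L] [Algebra K L] {α β : L}
    (hα : IsIntegral K α) (h : β ∈ K⟮α⟯) : ∃ p : K[X], aeval α p = β := by
  have h' : β ∈ (K⟮α⟯).toSubalgebra := h
  rw [IntermediateField.adjoin_simple_toSubalgebra_of_isAlgebraic hα.isAlgebraic,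
    Algebra.adjoin_singleton_eq_range_aeval] at h'
  exact h'

theorem isIntegral_of_root {L : Type*} [Field L] [Algebra K L] {f : K[X]} (hf : f ≠ 0) {α : L}
    (hα : aeval α f = 0) : IsIntegral K α :=
  isAlgebraic_iff_isIntegral.1 ⟨f, hf, hα⟩

theorem finrank_adjoin_root {L : Type*} [Field L] [Algebra K L] {f : K[X]} (hf : Irreducible f)
    {α : L} (hα : aeval α f = 0) : Module.finrank K K⟮α⟯ = f.natDegree := by
  rw [IntermediateField.adjoin.finrank (isIntegral_of_root hf.ne_zero hα)]
  exact natDegree_eq_of_degree_eq (degree_eq_degree_of_associated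
    (associated_of_dvd_dvd (minpoly.dvd K α hα)
      ((aeval_eq_zero_iff_dvd hf hα _).1 (minpoly.aeval K α))))

theorem exists_common_roots {f g : K[X]} (hf : Irreducible f) (hg : Irreducible g)
    (h : PolyEquiv f g) : ∃ α β : AlgebraicClosure K, aeval α f = 0 ∧ aeval β g = 0 ∧
      K⟮α⟯ = K⟮β⟯ := by
  rw [polyEquiv_iff hf.ne_zero hg.ne_zero] at h
  obtain ⟨α, hα⟩ := IsAlgClosed.exists_aeval_eq_zero (AlgebraicClosure K) f
    (degree_pos_of_irreducible hf).ne'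
  obtain ⟨β, hβ, e⟩ := h.1 α hα
  exact ⟨α, β, hα, hβ, e⟩

/-- Both degrees equal the degree over `K` of the common field `K(α) = K(β)`. -/
theorem natDegree_eq_of_polyEquiv {f g : K[X]} (hf : Irreducible f) (hg : Irreducible g)
    (h : PolyEquiv f g) : f.natDegree = g.natDegree := by
  obtain ⟨α, β, hα, hβ, e⟩ := exists_common_roots hf hg h
  rw [← finrank_adjoin_root hf hα, e, finrank_adjoin_root hg hβ]

/-- For equivalent `f` and `g` there is a substitution `b` for which `g(b(X))` is divisible by
`f` exactly once. -/
theorem exists_comp_dvd_not_sq_dvd {f g : K[X]} (hf : Irreducible f) (hg : Irreducible g)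
    (h : PolyEquiv f g) : ∃ b : K[X], f ∣ g.comp b ∧ ¬ f ^ 2 ∣ g.comp b := by
  obtain ⟨α, β, hα, hβ, e⟩ := exists_common_roots hf hg h
  obtain ⟨b, hb⟩ := exists_aeval_eq_of_mem_adjoin (isIntegral_of_root hf.ne_zero hα)
    (e ▸ IntermediateField.mem_adjoin_simple_self K β)
  obtain ⟨c, hc⟩ := exists_aeval_eq_of_mem_adjoin (isIntegral_of_root hg.ne_zero hβ)
    (e ▸ IntermediateField.mem_adjoin_simple_self K α)
  have hdiv : f ∣ g.comp b := by
    rw [← aeval_eq_zero_iff_dvd hf hα, aeval_comp, hb, hβ]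
  -- If `b` fails, `b + f` is tried: modulo `f ^ 2` this adds `g'(b) f`, which helps unless `g ∣
  -- g'`. The inseparable case must therefore be shown never to reach this branch.
  by_cases hsq : f ^ 2 ∣ g.comp b
  swap
  · exact ⟨b, hdiv, hsq⟩
  have hgf : g ∣ f.comp c := by
    rw [← aeval_eq_zero_iff_dvd hg hβ, aeval_comp, hc, hα]
  obtain ⟨l, hl⟩ : g ∣ b.comp c - X := by
    rw [← aeval_eq_zero_iff_dvd hg hβ, map_sub, aeval_comp, hc, hb, aeval_X, sub_self]
  obtain ⟨k, hk⟩ := exists_comp_add g X (g * l)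
  -- Since `b(c)` is `X` modulo `g`, expanding `g(b(c))` around `X` gives `g + g' g l` modulo `g ^
  -- 2`. If `g ∣ g'`, then `g ^ 2 ∣ g`, which is absurd.
  have hgc : g ^ 2 ∣ (g.comp b).comp c := by
    obtain ⟨w, hw⟩ := hsq
    rw [hw, mul_comp, pow_comp]
    exact (pow_dvd_pow_of_dvd hgf 2).mul_right _
  rw [comp_assoc, sub_eq_iff_eq_add'.1 hl, hk, comp_X, comp_X] at hgc
  have hder : ¬ g ∣ derivative g := by
    rintro ⟨d, hd⟩
    obtain ⟨r, hr⟩ := hgc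
    have h1 : g * 1 = g * (g * (r - d * l - k * l ^ 2)) := by
      rw [hd] at hr
      linear_combination hr
    exact hg.not_isUnit (IsUnit.of_mul_eq_one _ (mul_left_cancel₀ hg.ne_zero h1).symm)
  obtain ⟨k', hk'⟩ := exists_comp_add g b f
  refine ⟨b + f, ?_, ?_⟩
  · rw [← aeval_eq_zero_iff_dvd hf hα, aeval_comp, map_add, hb, hα, add_zero, hβ]
  · rw [hk', dvd_add_left (dvd_mul_left _ _), dvd_add_right hsq, pow_two,
      mul_dvd_mul_iff_right hf.ne_zero, ← aeval_eq_zero_iff_dvd hf hα, aeval_comp, hb,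
      aeval_eq_zero_iff_dvd hg hβ]
    exact hder

/-- If `f` divides `g(b(X))` exactly once, then `f ^ t` divides `q(b(X))` just when `g ^ t`
divides `q`. -/
theorem pow_dvd_comp_iff {f g b : K[X]} (hf : Irreducible f) (hg : Irreducible g)
    (h1 : f ∣ g.comp b) (h2 : ¬ f ^ 2 ∣ g.comp b) (t : ℕ) (q : K[X]) :
    f ^ t ∣ q.comp b ↔ g ^ t ∣ q := by
  constructor
  · intro h
    rcases eq_or_ne q 0 with rfl | hq
    · exact dvd_zero _
    obtain ⟨r, hr, hnd⟩ :=
      -- With `q = g ^ s * r` and `g(b) = f * u`, both `u` and `r(b)` are coprime to `f`, so `f`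
      -- divides `q(b)` exactly `s` times.
      (FiniteMultiplicity.of_not_isUnit hg.not_isUnit hq).exists_eq_pow_mul_and_not_dvd
    set s := multiplicity g q
    obtain ⟨x, y, hxy⟩ := hg.coprime_iff_not_dvd.2 hnd
    have hcop : IsCoprime f (r.comp b) := by
      obtain ⟨u, hu⟩ := h1
      refine ⟨x.comp b * u, y.comp b, ?_⟩
      have := congrArg (fun p => p.comp b) hxy
      simp only [add_comp, mul_comp, hu, one_comp] at this
      linear_combination this
    obtain ⟨u, hu⟩ := h1
    have hfu : IsCoprime f u := by
      rw [hf.coprime_iff_not_dvd]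
      rintro ⟨z, rfl⟩
      exact h2 ⟨z, by rw [hu]; ring⟩
    rw [hr, mul_comp, pow_comp, hu, mul_pow] at h
    have h3 := (hcop.pow_left (m := t)).dvd_of_dvd_mul_right h
    have h4 := (hfu.pow (m := t) (n := s)).dvd_of_dvd_mul_right h3
    have h5 := (pow_dvd_pow_iff hf.ne_zero hf.not_isUnit).1 h4
    rw [hr]
    exact (pow_dvd_pow g h5).mul_right _
  · rintro ⟨r, rfl⟩
    rw [mul_comp, pow_comp]
    exact (pow_dvd_pow_of_dvd h1 t).mul_right _

end Substitution

/-! ### Independence of the partitions from the decomposition, via ranks. -/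

section Uniqueness

variable {K : Type u} [Field K] {V : Type*} [AddCommGroup V] [Module K V]
  {W : Type*} [AddCommGroup W] [Module K W]

theorem finrank_iSup_of_iSupIndep [FiniteDimensional K V] {ι : Type*} [Fintype ι]
    {A : ι → Submodule K V} (h : iSupIndep A) :
    Module.finrank K (⨆ i, A i : Submodule K V) = ∑ i, Module.finrank K (A i) := by
  classical
  rw [Submodule.iSup_eq_range_dfinsupp_lsum,
    LinearMap.finrank_range_of_inj h.dfinsupp_lsum_injective]
  exact Module.finrank_directSum (R := K) (fun i => A i)

theorem MonicIrred.isCoprime {f g : MonicIrred K} (h : f ≠ g) : IsCoprime f.1 g.1 := by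
  rw [f.2.1.coprime_iff_not_dvd]
  intro hd
  exact h (Subtype.ext (eq_of_monic_of_associated f.2.2 g.2.2
    (f.2.1.associated_of_dvd g.2.1 hd)))

open scoped Classical in
/-- The exponents attached to `f` in an indecomposable decomposition. -/
def IndecDecomp.parts {T : Module.End K V} (D : IndecDecomp T) (f : MonicIrred K) :
    Multiset ℕ :=
  (Finset.univ.filter fun i => D.poly i = f).val.map D.exp

theorem finrank_range_aeval_eq {T : Module.End K V} {S : Module.End K W} (Φ : V ≃ₗ[K] W)
    (h : ∀ x, Φ (T x) = S (Φ x)) (p : K[X]) :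
    Module.finrank K (LinearMap.range (aeval T p)) =
      Module.finrank K (LinearMap.range (aeval S p)) := by
  have : LinearMap.range (aeval S p) = (LinearMap.range (aeval T p)).map Φ.toLinearMap := by
    have hc : ∀ x, Φ (aeval T p x) = aeval S p (Φ x) := fun x =>
      (aeval_intertwine (U := ⊤) (fun _ _ => trivial) Φ.toLinearMap (fun u _ => h u) p x
        trivial).2
    ext y
    constructor
    · rintro ⟨x, rfl⟩
      exact ⟨aeval T p (Φ.symm x), ⟨_, rfl⟩, by
        rw [LinearEquiv.coe_coe, hc, LinearEquiv.apply_symm_apply]⟩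
    · rintro ⟨_, ⟨x, rfl⟩, rfl⟩
      exact ⟨Φ x, (hc x).symm⟩
  rw [this]
  exact (LinearEquiv.finrank_map_eq Φ _).symm

/-- The multiplicity of `b + 1` is the difference of consecutive tail counts; the multiplicity of
`0` is not seen by them, whence the two exclusions. -/
theorem _root_.Multiset.eq_of_countP_lt_eq {s t : Multiset ℕ} (hs : 0 ∉ s) (ht : 0 ∉ t)
    (h : ∀ k, s.countP (k < ·) = t.countP (k < ·)) : s = t := by
  have key : ∀ (m : Multiset ℕ) (b : ℕ),
      m.countP (b < ·) = m.countP (b + 1 < ·) + m.count (b + 1) := by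
    intro m b
    induction m using Multiset.induction_on with
    | empty => simp
    | cons a m ih =>
      rw [Multiset.countP_cons, Multiset.countP_cons, Multiset.count_cons, ih]
      split_ifs <;> omega
  ext a
  rcases a with _ | b
  · rw [Multiset.count_eq_zero.2 hs, Multiset.count_eq_zero.2 ht]
  · have h1 := key s b
    have h2 := key t b
    rw [h b, h (b + 1)] at h1
    omega

theorem IndecDecomp.zero_notMem_parts {T : Module.End K V} (D : IndecDecomp T)
    (f : MonicIrred K) : 0 ∉ D.parts f := by
  intro h
  obtain ⟨i, _, hi⟩ := Multiset.mem_map.1 h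
  exact (D.exp_pos i).ne' hi

theorem IndecDecomp.parts_ne_zero_iff {T : Module.End K V} (D : IndecDecomp T)
    (f : MonicIrred K) : D.parts f ≠ 0 ↔ ∃ i, D.poly i = f := by
  classical
  rw [IndecDecomp.parts, ne_eq, Multiset.map_eq_zero, Finset.val_eq_zero,
    Finset.filter_eq_empty_iff]
  simp

variable [FiniteDimensional K V] [FiniteDimensional K W]

theorem IndecDecomp.exists_generator {T : Module.End K V} (D : IndecDecomp T) (i : Fin D.size) :
    ∃ v, LinearMap.range (orbitMap T v) = D.space i ∧
      ∀ q, aeval T q v = 0 ↔ (D.poly i).1 ^ D.exp i ∣ q :=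
  GenType.exists_generator (D.invariant i) (D.indecomposable i) (D.poly i).2.1 (D.minpoly_eq i)

theorem IndecDecomp.finrank_space {T : Module.End K V} (D : IndecDecomp T) (i : Fin D.size) :
    Module.finrank K (D.space i) = D.exp i * (D.poly i).1.natDegree := by
  obtain ⟨v, hv, h⟩ := D.exists_generator i
  rw [finrank_of_generator hv h, natDegree_pow]

-- The image is cyclic, generated by `f(T) ^ k v`. Its annihilator loses `k` factors of `f` when the
-- summand belongs to `f`, and is unchanged when its polynomial is coprime to `f`.
open scoped Classical in
theorem IndecDecomp.finrank_map {T : Module.End K V} (D : IndecDecomp T) (f : MonicIrred K)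
    (k : ℕ) (i : Fin D.size) :
    Module.finrank K ((D.space i).map (aeval T (f.1 ^ k))) =
      if D.poly i = f then (D.exp i - k) * f.1.natDegree
      else D.exp i * (D.poly i).1.natDegree := by
  obtain ⟨v, hv, h⟩ := D.exists_generator i
  have hr : LinearMap.range (orbitMap T (aeval T (f.1 ^ k) v)) =
      (D.space i).map (aeval T (f.1 ^ k)) := by
    rw [← hv, ← LinearMap.range_comp]
    congr 1
    refine LinearMap.ext fun q => ?_
    exact aeval_comm_apply T q _ v
  split_ifs with hf
  · rw [← natDegree_pow]
    refine finrank_of_generator hr fun q => ?_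
    rw [← aeval_mul_apply, h, hf]
    rcases le_total k (D.exp i) with hk | hk
    · conv_lhs => rw [← Nat.sub_add_cancel hk, pow_add]
      exact mul_dvd_mul_iff_right (pow_ne_zero _ f.2.1.ne_zero)
    -- Truncated subtraction gives exponent `0` here, as it should: the image is zero.
    · rw [Nat.sub_eq_zero_of_le hk, pow_zero]
      exact iff_of_true ((pow_dvd_pow _ hk).mul_left _) (one_dvd _)
  · rw [← natDegree_pow]
    refine finrank_of_generator hr fun q => ?_
    rw [← aeval_mul_apply, h]
    exact ⟨(MonicIrred.isCoprime hf).pow.dvd_of_dvd_mul_right, fun hd => hd.mul_right _⟩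

open scoped Classical in
theorem IndecDecomp.finrank_range {T : Module.End K V} (D : IndecDecomp T) (f : MonicIrred K)
    (k : ℕ) : Module.finrank K (LinearMap.range (aeval T (f.1 ^ k))) =
      ∑ i, if D.poly i = f then (D.exp i - k) * f.1.natDegree
      else D.exp i * (D.poly i).1.natDegree := by
  have hi := (DirectSum.isInternal_submodule_iff_iSupIndep_and_iSup_eq_top _).1 D.internal
  have hle : ∀ i, (D.space i).map (aeval T (f.1 ^ k)) ≤ D.space i := by
    rintro i _ ⟨u, hu, rfl⟩
    exact (D.invariant i).aeval_mem _ hu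
  rw [← Submodule.map_top, ← hi.2, Submodule.map_iSup,
    finrank_iSup_of_iSupIndep (hi.1.mono hle)]
  exact Finset.sum_congr rfl fun i _ => D.finrank_map f k i

/-- Each successive rank drop counts the parts exceeding `k`, and ranks do not depend on the
decomposition. -/
theorem IndecDecomp.finrank_range_succ {T : Module.End K V} (D : IndecDecomp T)
    (f : MonicIrred K) (k : ℕ) :
    Module.finrank K (LinearMap.range (aeval T (f.1 ^ k))) =
      Module.finrank K (LinearMap.range (aeval T (f.1 ^ (k + 1)))) +
        (D.parts f).countP (k < ·) * f.1.natDegree := by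
  classical
  have hc : (D.parts f).countP (k < ·) =
      ∑ i, if D.poly i = f then (if k < D.exp i then 1 else 0) else 0 := by
    rw [IndecDecomp.parts, Multiset.countP_map, ← Finset.filter_val, Finset.card_val,
      Finset.card_filter, Finset.sum_filter]
  rw [D.finrank_range, D.finrank_range, hc, Finset.sum_mul, ← Finset.sum_add_distrib]
  refine Finset.sum_congr rfl fun i _ => ?_
  -- The truncated difference `exp - k` falls by one exactly while `k < exp`.
  split_ifs with h1 h2
  · rw [← add_mul]
    congr 1
    omega
  · rw [← add_mul]
    congr 1
    omega
  · omega

/-- The exponents attached to `f` do not depend on the decomposition, and are the same for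
similar endomorphisms. -/
theorem IndecDecomp.parts_eq {T : Module.End K V} {S : Module.End K W} (D : IndecDecomp T)
    (E : IndecDecomp S) (Φ : V ≃ₗ[K] W) (h : ∀ x, Φ (T x) = S (Φ x)) (f : MonicIrred K) :
    D.parts f = E.parts f := by
  refine Multiset.eq_of_countP_lt_eq (D.zero_notMem_parts f) (E.zero_notMem_parts f)
    fun k => ?_
  have h1 := D.finrank_range_succ f k
  have h2 := E.finrank_range_succ f k
  rw [finrank_range_aeval_eq Φ h, finrank_range_aeval_eq Φ h, h2] at h1
  exact (Nat.eq_of_mul_eq_mul_right f.2.1.natDegree_pos (Nat.add_left_cancel h1)).symm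

end Uniqueness

/-! ### Endomorphisms with the same centralizer. -/

section SameCentralizer

variable {K : Type u} [Field K] {V : Type*} [AddCommGroup V] [Module K V]

theorem Invariant.sup {T : Module.End K V} {A B : Submodule K V} (hA : Invariant T A)
    (hB : Invariant T B) : Invariant T (A ⊔ B) := by
  have : A ⊔ B ≤ (A ⊔ B).comap T :=
    sup_le (fun v hv => Submodule.mem_sup_left (hA v hv))
      (fun v hv => Submodule.mem_sup_right (hB v hv))
  exact this

theorem Invariant.iSup {T : Module.End K V} {ι : Sort*} {A : ι → Submodule K V}
    (h : ∀ i, Invariant T (A i)) : Invariant T (⨆ i, A i) := by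
  have : ⨆ i, A i ≤ (⨆ i, A i).comap T :=
    iSup_le fun i v hv => Submodule.mem_iSup_of_mem i (h i v hv)
  exact this

/-- A complemented invariant subspace of `T` is invariant under everything that commutes with
the centralizer of `T`. -/
theorem invariant_of_isCompl {T S : Module.End K V} (hC : ∀ Z, Commute Z T → Commute Z S)
    {A B : Submodule K V} (hAB : IsCompl A B) (hA : Invariant T A) (hB : Invariant T B) :
    Invariant S A := by
  have hcomm : Commute (A.projection B hAB) T := by
    -- The projection onto `A` along `B` commutes with `T` as both are invariant, hence with `S`; so
    -- `S` preserves its range.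
    ext x
    have h1 := hA _ (Submodule.projection_apply_mem hAB x)
    have h2 := hB _ (Submodule.sub_projection_mem hAB x)
    rw [Module.End.mul_apply, Module.End.mul_apply]
    conv_lhs => rw [← add_sub_cancel (A.projection B hAB x) x, map_add, map_add]
    rw [Submodule.projection_apply_of_mem_left hAB h1,
      (Submodule.projection_apply_eq_zero_iff hAB).2 h2, add_zero]
  intro v hv
  have h := LinearMap.congr_fun (hC _ hcomm) v
  rw [Module.End.mul_apply, Module.End.mul_apply,
    Submodule.projection_apply_of_mem_left hAB hv] at h
  rw [← h]
  exact Submodule.projection_apply_mem hAB _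

namespace IndecDecomp

variable {T : Module.End K V} (D : IndecDecomp T)

/-- The sum of the other summands. -/
def cocomponent (i : Fin D.size) : Submodule K V := ⨆ (j) (_ : j ≠ i), D.space j

theorem invariant_cocomponent (i : Fin D.size) : Invariant T (D.cocomponent i) :=
  Invariant.iSup fun j => Invariant.iSup fun _ => D.invariant j

theorem isCompl_cocomponent (i : Fin D.size) : IsCompl (D.space i) (D.cocomponent i) := by
  have hi := (DirectSum.isInternal_submodule_iff_iSupIndep_and_iSup_eq_top _).1 D.internal
  refine ⟨hi.1 i, ?_⟩
  rw [codisjoint_iff, eq_top_iff, ← hi.2]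
  refine iSup_le fun j => ?_
  by_cases h : j = i
  · exact h ▸ le_sup_left
  · exact le_sup_of_le_right (le_iSup₂_of_le j h le_rfl)

theorem invariant_of_commute {S : Module.End K V} (hC : ∀ Z, Commute Z T → Commute Z S)
    (i : Fin D.size) : Invariant S (D.space i) :=
  invariant_of_isCompl hC (D.isCompl_cocomponent i) (D.invariant i) (D.invariant_cocomponent i)

theorem indecomposable_of_commute {S : Module.End K V} (hC : ∀ Z, Commute Z T ↔ Commute Z S)
    (i : Fin D.size) : Indecomposable S (D.space i) := by
  refine ⟨(D.indecomposable i).1, fun A B hA hB hAB hs => ?_⟩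
  have hco := invariant_of_isCompl (fun Z => (hC Z).1) (D.isCompl_cocomponent i).symm
    (D.invariant_cocomponent i) (D.invariant i)
  -- `A` is complemented in all of `V` by the `S`-invariant `B ⊔ D.cocomponent i`, so it is
  -- `T`-invariant as well.
  have key : ∀ A B : Submodule K V, Invariant S A → Invariant S B → A ⊓ B = ⊥ →
      A ⊔ B = D.space i → Invariant T A := by
    intro A B hA hB hAB hs
    refine invariant_of_isCompl (B := B ⊔ D.cocomponent i) (fun Z => (hC Z).2) ⟨?_, ?_⟩ hA
      (hB.sup hco)
    · rw [Submodule.disjoint_def]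
      intro x hx hx'
      obtain ⟨b, hb, c, hc, rfl⟩ := Submodule.mem_sup.1 hx'
      have hcU : c ∈ D.space i := by
        rw [← hs]
        have := Submodule.sub_mem (A ⊔ B) (Submodule.mem_sup_left hx)
          (Submodule.mem_sup_right hb)
        rwa [add_sub_cancel_left] at this
      have hc0 : c = 0 := (Submodule.disjoint_def.1 (D.isCompl_cocomponent i).disjoint) c hcU hc
      subst hc0
      rw [add_zero] at hx ⊢
      rw [← Submodule.mem_bot K, ← hAB]
      exact ⟨hx, hb⟩
    · rw [codisjoint_iff, ← sup_assoc, hs]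
      exact (D.isCompl_cocomponent i).sup_eq_top
  exact (D.indecomposable i).2 A B (key A B hA hB hAB hs)
    (key B A hB hA (by rw [inf_comm, hAB]) (by rw [sup_comm, hs])) hAB hs

/-- An indecomposable decomposition for `T` is one for every `S` with the same centralizer. -/
theorem exists_same_space [FiniteDimensional K V] {S : Module.End K V}
    (hC : ∀ Z, Commute Z T ↔ Commute Z S) :
    ∃ (E : IndecDecomp S) (e : Fin D.size ≃ Fin E.size), ∀ i, E.space (e i) = D.space i := by
  have hinv := D.invariant_of_commute fun Z => (hC Z).1
  have hind := D.indecomposable_of_commute hC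
  choose f t ht hm using fun i => exists_minpoly_eq (hinv i) (hind i)
  exact ⟨⟨D.size, D.space, D.internal, hinv, hind, f, t, ht, hm⟩, Equiv.refl _, fun _ => rfl⟩

end IndecDecomp

theorem aeval_eq_zero_of_mem_orbit {T : Module.End K V} {v : V} {m : K[X]}
    (h : aeval T m v = 0) {u : V} (hu : u ∈ LinearMap.range (orbitMap T v)) :
    aeval T m u = 0 := by
  obtain ⟨q, rfl⟩ := hu
  rw [orbitMap_apply, aeval_comm_apply, h, map_zero]

/-- Commuting endomorphisms for which the same invariant subspace is cyclic are polynomials in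
each other there. -/
theorem exists_aeval_eqOn {T S : Module.End K V} (hTS : Commute T S) {U : Submodule K V} {v : V}
    (hv : LinearMap.range (orbitMap T v) = U) (hS : Invariant S U) :
    ∃ p : K[X], ∀ u ∈ U, S u = aeval T p u := by
  have hvU : v ∈ U := hv ▸ ⟨1, by simp⟩
  obtain ⟨p, hp⟩ : S v ∈ LinearMap.range (orbitMap T v) := hv.symm ▸ hS v hvU
  refine ⟨p, fun u hu => ?_⟩
  obtain ⟨q, rfl⟩ : u ∈ LinearMap.range (orbitMap T v) := hv.symm ▸ hu
  have h1 : S (aeval T q v) = aeval T q (S v) :=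
    (aeval_intertwine (U := ⊤) (fun _ _ => trivial) S
      (fun x _ => (LinearMap.congr_fun hTS x).symm) q v trivial).2
  rw [orbitMap_apply, h1, ← hp, orbitMap_apply, aeval_comm_apply]

theorem aeval_mem_intermediateField {L : Type*} [Field L] [Algebra K L]
    {F : IntermediateField K L} {a : L} (ha : a ∈ F) (p : K[X]) : aeval a p ∈ F := by
  have h : Algebra.adjoin K {a} ≤ F.toSubalgebra :=
    Algebra.adjoin_le (Set.singleton_subset_iff.2 ha)
  exact h (aeval_mem_adjoin_singleton K a)

/-- The root `p(α)` of `g` lies in `K(α)`, and `α = q(p(α))` lies in `K(p(α))`. -/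
theorem adjoin_eq_of_mutual {L : Type*} [Field L] [Algebra K L] {f g p q : K[X]}
    (hgf : f ∣ g.comp p) (hqp : f ∣ q.comp p - X) {α : L} (hα : aeval α f = 0) :
    aeval (aeval α p) g = 0 ∧ K⟮α⟯ = K⟮aeval α p⟯ := by
  have hz : ∀ r : K[X], f ∣ r → aeval α r = 0 := by
    rintro _ ⟨r, rfl⟩
    simp [hα]
  have h1 := hz _ hgf
  have h2 := hz _ hqp
  rw [aeval_comp] at h1
  rw [map_sub, aeval_comp, aeval_X, sub_eq_zero] at h2
  refine ⟨h1, le_antisymm ?_ ?_⟩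
  · rw [IntermediateField.adjoin_simple_le_iff]
    have h3 := aeval_mem_intermediateField (IntermediateField.mem_adjoin_simple_self K (aeval α p)) q
    rwa [h2] at h3
  · rw [IntermediateField.adjoin_simple_le_iff]
    exact aeval_mem_intermediateField (IntermediateField.mem_adjoin_simple_self K α) p

theorem polyEquiv_of_generators {T S : Module.End K V} (hTS : Commute T S) {U : Submodule K V}
    (hT : Invariant T U) (hS : Invariant S U) {f g : K[X]} (hf : Irreducible f)
    (hg : Irreducible g) {t s : ℕ} (ht : 0 < t) (hs : 0 < s) {v w : V}
    (hv : LinearMap.range (orbitMap T v) = U) (hw : LinearMap.range (orbitMap S w) = U)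
    (hfv : ∀ q, aeval T q v = 0 ↔ f ^ t ∣ q) (hgw : ∀ q, aeval S q w = 0 ↔ g ^ s ∣ q) :
    PolyEquiv f g ∧ t = s := by
  -- Stated for arbitrary data so that it applies with `T` and `S` exchanged. It evaluates `g(S) ^ s
  -- = 0` and `q(S) = T` at the generator `v`, using `S = p(T)` on `U`.
  have key : ∀ {T S : Module.End K V} (_ : Invariant T U) (_ : Invariant S U) {f g p q : K[X]}
      (_ : Irreducible f) {t s : ℕ} (_ : 0 < t) {v w : V}
      (_ : LinearMap.range (orbitMap T v) = U) (_ : LinearMap.range (orbitMap S w) = U)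
      (_ : ∀ q, aeval T q v = 0 ↔ f ^ t ∣ q) (_ : ∀ q, aeval S q w = 0 ↔ g ^ s ∣ q)
      (_ : ∀ u ∈ U, S u = aeval T p u) (_ : ∀ u ∈ U, T u = aeval S q u),
      f ∣ g.comp p ∧ f ∣ q.comp p - X := by
    intro T S hT hS f g p q hf t s ht v w hv hw hfv hgw hp hq
    have hvU : v ∈ U := hv ▸ ⟨1, by simp⟩
    have hft : f ∣ f ^ t := dvd_pow_self f ht.ne'
    have hcomp : ∀ r : K[X], aeval T (r.comp p) v = aeval S r v := fun r => by
      rw [aeval_comp_apply, aeval_eq_of_eqOn hS hp r hvU]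
    constructor
    · refine hf.prime.dvd_of_dvd_pow (n := s) (hft.trans ?_)
      rw [← pow_comp, ← hfv, hcomp]
      exact aeval_eq_zero_of_mem_orbit ((hgw _).2 dvd_rfl) (hw.symm ▸ hvU)
    · refine hft.trans ?_
      rw [← hfv, map_sub, LinearMap.sub_apply, hcomp, aeval_X, hq v hvU, sub_self]
  obtain ⟨p, hp⟩ := exists_aeval_eqOn hTS hv hS
  obtain ⟨q, hq⟩ := exists_aeval_eqOn hTS.symm hw hT
  obtain ⟨a1, a2⟩ := key hT hS hf ht hv hw hfv hgw hp hq
  obtain ⟨b1, b2⟩ := key hS hT hg hs hw hv hgw hfv hq hp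
  have he : PolyEquiv f g :=
    ⟨fun α hα => ⟨_, adjoin_eq_of_mutual a1 a2 hα⟩,
      fun β hβ => ⟨_, (adjoin_eq_of_mutual b1 b2 hβ).imp_right Eq.symm⟩⟩
  refine ⟨he, ?_⟩
  -- The dimension of `U` is both `t * deg f` and `s * deg g`, and the degrees agree.
  have h1 := finrank_of_generator hv hfv
  rw [finrank_of_generator hw hgw, natDegree_pow, natDegree_pow,
    natDegree_eq_of_polyEquiv hf hg he] at h1
  exact (Nat.eq_of_mul_eq_mul_right hg.natDegree_pos h1).symm

namespace IndecDecomp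

variable [FiniteDimensional K V] {T S : Module.End K V} (D : IndecDecomp T) (E : IndecDecomp S)

theorem polyEquiv_and_exp_eq (hTS : Commute T S) {i : Fin D.size} {j : Fin E.size}
    (h : E.space j = D.space i) :
    PolyEquiv (D.poly i).1 (E.poly j).1 ∧ D.exp i = E.exp j := by
  obtain ⟨v, hv, hfv⟩ := D.exists_generator i
  obtain ⟨w, hw, hgw⟩ := E.exists_generator j
  exact polyEquiv_of_generators hTS (D.invariant i) (h ▸ E.invariant j) (D.poly i).2.1
    (E.poly j).2.1 (D.exp_pos i) (E.exp_pos j) hv (hw.trans h) hfv hgw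

theorem aeval_poly_pow_eq_zero (i : Fin D.size) {u : V} (hu : u ∈ D.space i) :
    aeval T ((D.poly i).1 ^ D.exp i) u = 0 := by
  obtain ⟨v, hv, h⟩ := D.exists_generator i
  exact aeval_eq_zero_of_mem_orbit ((h _).2 dvd_rfl) (hv.symm ▸ hu)

/-- If two summands have the same irreducible polynomial for `T`, some endomorphism commuting
with `T` maps a vector of the first to a nonzero vector of the second. -/
theorem exists_commute_map {i j : Fin D.size} (h : D.poly i = D.poly j) :
    ∃ Z : Module.End K V, Commute Z T ∧ ∃ v ∈ D.space i, Z v ∈ D.space j ∧ Z v ≠ 0 := by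
  obtain ⟨v, hv, hfv⟩ := D.exists_generator i
  obtain ⟨w, hw, hfw⟩ := D.exists_generator j
  have hwU : w ∈ D.space j := hw ▸ ⟨1, by simp⟩
  -- With one factor short of the annihilator of `w`, `u` is nonzero but killed by the common
  -- irreducible polynomial, hence by everything that kills `v`.
  set u := aeval T ((D.poly j).1 ^ (D.exp j - 1)) w with hu
  have hu0 : u ≠ 0 := by
    rw [hu, ne_eq, hfw, pow_dvd_pow_iff (D.poly j).2.1.ne_zero (D.poly j).2.1.not_isUnit]
    have := D.exp_pos j
    omega
  have hfu : aeval T (D.poly j).1 u = 0 := by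
    rw [hu, ← aeval_mul_apply, hfw, ← pow_succ', Nat.sub_add_cancel (D.exp_pos j)]
  obtain ⟨φ, hφ⟩ := exists_orbit_hom (T := T) (S := T) (v := v) (w := u) (fun q hq => by
    obtain ⟨r, rfl⟩ := (dvd_pow_self _ (D.exp_pos i).ne').trans ((hfv q).1 hq)
    rw [mul_comm, aeval_mul_apply, h, hfu, map_zero])
  have hcompl := D.isCompl_cocomponent i
  rw [← hv] at hcompl
  -- Extension by zero on the complement commutes with `T` because that complement is invariant.
  let Z : Module.End K V := φ ∘ₗ Submodule.projectionOnto _ _ hcompl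
  have hZ : ∀ q : K[X], Z (aeval T q v) = aeval T q u := fun q => by
    have hm : aeval T q v ∈ LinearMap.range (orbitMap T v) := ⟨q, rfl⟩
    simp only [Z, LinearMap.comp_apply]
    rw [Submodule.projectionOnto_apply_of_mem_left hcompl hm, hφ]
  have hZ0 : ∀ x ∈ D.cocomponent i, Z x = 0 := fun x hx => by
    simp only [Z, LinearMap.comp_apply]
    rw [(Submodule.projectionOnto_apply_eq_zero_iff hcompl).2 hx, map_zero]
  have hZv : Z v = u := by simpa using hZ 1
  refine ⟨Z, ?_, v, hv ▸ ⟨1, by simp⟩, ?_, ?_⟩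
  · ext x
    have hx : x ∈ LinearMap.range (orbitMap T v) ⊔ D.cocomponent i := by
      rw [hcompl.sup_eq_top]; trivial
    obtain ⟨_, ⟨q, rfl⟩, y, hy, rfl⟩ := Submodule.mem_sup.1 hx
    have e1 : T (aeval T q v) = aeval T (X * q) v := by rw [aeval_mul_apply, aeval_X]
    rw [Module.End.mul_apply, Module.End.mul_apply, orbitMap_apply, map_add, map_add, map_add,
      hZ0 y hy, hZ0 _ (D.invariant_cocomponent i y hy), e1, hZ, hZ, aeval_mul_apply, aeval_X,
      add_zero, add_zero]
  · rw [hZv]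
    exact (D.invariant j).aeval_mem _ hwU
  · rwa [hZv]

/-- The vector `Z v` is killed by a power of each of the two polynomials of `S`; were they distinct,
hence coprime, it would vanish. -/
theorem poly_eq_of_poly_eq (hC : ∀ Z, Commute Z T → Commute Z S) {i j : Fin D.size}
    {i' j' : Fin E.size} (hi : E.space i' = D.space i) (hj : E.space j' = D.space j)
    (h : D.poly i = D.poly j) : E.poly i' = E.poly j' := by
  obtain ⟨Z, hZ, v, hv, hZv, hne⟩ := D.exists_commute_map h
  have hZS := hC Z hZ
  by_contra hc
  apply hne
  have h1 : aeval S ((E.poly i').1 ^ E.exp i') (Z v) = 0 := by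
    rw [← (aeval_intertwine (U := ⊤) (fun _ _ => trivial) Z
      (fun x _ => LinearMap.congr_fun hZS x) _ v trivial).2,
      E.aeval_poly_pow_eq_zero i' (hi.symm ▸ hv), map_zero]
  have h2 := E.aeval_poly_pow_eq_zero j' (hj.symm ▸ hZv)
  obtain ⟨a, b, hab⟩ := (MonicIrred.isCoprime hc).pow (m := E.exp i') (n := E.exp j')
  have h3 : aeval S (1 : K[X]) (Z v) = 0 := by
    rw [← hab, map_add, LinearMap.add_apply, aeval_mul_apply, aeval_mul_apply, h1, h2,
      map_zero, map_zero, add_zero]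
  simpa using h3

end IndecDecomp

end SameCentralizer

/-! ### From matching decompositions to conjugate centralizers. -/

section SameType

variable {K : Type u} [Field K] {V : Type*} [AddCommGroup V] [Module K V]
  {W : Type*} [AddCommGroup W] [Module K W]

/-- Isomorphisms between corresponding summands glue together. -/
theorem exists_equiv_of_isInternal {ι : Type*} [DecidableEq ι] {A : ι → Submodule K V}
    {B : ι → Submodule K W} (hA : DirectSum.IsInternal A) (hB : DirectSum.IsInternal B)
    (φ : ∀ i, A i ≃ₗ[K] B i) : ∃ Φ : V ≃ₗ[K] W, ∀ i (u : A i), Φ u = φ i u := by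
  let a := LinearEquiv.ofBijective (DirectSum.coeLinearMap A) hA
  let b := LinearEquiv.ofBijective (DirectSum.coeLinearMap B) hB
  refine ⟨a.symm ≪≫ₗ DFinsupp.mapRange.linearEquiv φ ≪≫ₗ b, fun i u => ?_⟩
  have h1 : a.symm u = DirectSum.lof K ι (fun i => A i) i u := by
    rw [LinearEquiv.symm_apply_eq]
    exact (DirectSum.coeLinearMap_lof A i u).symm
  have h2 : DFinsupp.mapRange.linearEquiv φ (DirectSum.lof K ι (fun i => A i) i u) =
      DirectSum.lof K ι (fun i => B i) i (φ i u) :=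
    DFinsupp.mapRange_single (hf := fun i => map_zero (φ i))
  rw [LinearEquiv.trans_apply, LinearEquiv.trans_apply, h1, h2]
  exact DirectSum.coeLinearMap_lof B i _

theorem dvd_comp_sub_comp (g p b : K[X]) : p - b ∣ g.comp p - g.comp b := by
  have h := sub_dvd_eval_sub p b (g.map C)
  simpa [eval_map, comp] using h

theorem IndecDecomp.exists_substitution {T : Module.End K V} {S : Module.End K W}
    (D : IndecDecomp T) (E : IndecDecomp S) (e : Fin D.size ≃ Fin E.size)
    (hpoly : ∀ i, PolyEquiv (D.poly i).1 (E.poly (e i)).1)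
    (heq : ∀ i j, D.poly i = D.poly j → E.poly (e i) = E.poly (e j)) :
    ∃ p : K[X], ∀ i, (D.poly i).1 ∣ (E.poly (e i)).1.comp p ∧
      ¬ (D.poly i).1 ^ 2 ∣ (E.poly (e i)).1.comp p := by
  choose b hb using fun i => exists_comp_dvd_not_sq_dvd (D.poly i).2.1 (E.poly (e i)).2.1 (hpoly i)
  -- Dividing exactly once is a condition modulo the square, so congruences modulo each `f ^ 2`
  -- suffice. They are indexed by the distinct polynomials, for coprimality; `heq` lets one choice
  -- of `b` serve all summands with the same `f`.
  obtain ⟨p, hp⟩ := Ideal.exists_forall_sub_mem_ideal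
    (I := fun F : Set.range D.poly => Ideal.span {F.1.1 ^ 2})
    (fun F G hFG => by
      rw [Function.onFun, Ideal.isCoprime_span_singleton_iff]
      exact (MonicIrred.isCoprime fun h => hFG (Subtype.ext h)).pow)
    (fun F => b F.2.choose)
  refine ⟨p, fun i => ?_⟩
  let F : Set.range D.poly := ⟨D.poly i, i, rfl⟩
  have hF : D.poly F.2.choose = D.poly i := F.2.choose_spec
  have hF' := heq _ _ hF
  have h1 := (Ideal.mem_span_singleton.1 (hp F)).trans
    (dvd_comp_sub_comp (E.poly (e i)).1 p (b F.2.choose))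
  have h2 := hb F.2.choose
  rw [hF, hF'] at h2
  exact ⟨(dvd_iff_dvd_of_dvd_sub ((dvd_pow_self _ two_ne_zero).trans h1)).2 h2.1,
    fun h => h2.2 ((dvd_iff_dvd_of_dvd_sub h1).1 h)⟩

/-- What commutes with `T` commutes with `p(T)`, which `Φ` carries to `S`. -/
theorem commute_conj_of_aeval {T : Module.End K V} {S : Module.End K W} {p : K[X]}
    {Φ : V ≃ₗ[K] W} (h : ∀ x, Φ (aeval T p x) = S (Φ x)) {Z : Module.End K V}
    (hZ : Commute Z T) : Commute (Φ.conj Z) S := by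
  ext y
  obtain ⟨x, rfl⟩ := Φ.surjective y
  have h1 : Z (aeval T p x) = aeval T p (Z x) :=
    (aeval_intertwine (U := ⊤) (fun _ _ => trivial) Z
      (fun u _ => LinearMap.congr_fun hZ u) p x trivial).2
  rw [Module.End.mul_apply, Module.End.mul_apply, ← h, LinearEquiv.conj_apply_apply,
    LinearEquiv.conj_apply_apply, LinearEquiv.symm_apply_apply, LinearEquiv.symm_apply_apply,
    h1, h]

variable [FiniteDimensional K V] [FiniteDimensional K W]

/-- If decompositions of `T` and `S` match up to equivalence of polynomials, then `S` is similar
to a polynomial in `T`. -/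
theorem IndecDecomp.exists_aeval_conj {T : Module.End K V} {S : Module.End K W}
    (D : IndecDecomp T) (E : IndecDecomp S) (e : Fin D.size ≃ Fin E.size)
    (hpoly : ∀ i, PolyEquiv (D.poly i).1 (E.poly (e i)).1)
    (hexp : ∀ i, D.exp i = E.exp (e i))
    (heq : ∀ i j, D.poly i = D.poly j → E.poly (e i) = E.poly (e j)) :
    ∃ (p : K[X]) (Φ : V ≃ₗ[K] W), ∀ x, Φ (aeval T p x) = S (Φ x) := by
  obtain ⟨p, hp⟩ := D.exists_substitution E e hpoly heq
  set R := aeval T p with hR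
  have hDE := (DirectSum.isInternal_submodule_iff_iSupIndep_and_iSup_eq_top _).1 E.internal
  have hE : DirectSum.IsInternal fun i => E.space (e i) := by
    rw [DirectSum.isInternal_submodule_iff_iSupIndep_and_iSup_eq_top]
    exact ⟨hDE.1.comp e.injective, by rw [← hDE.2]; exact Equiv.iSup_comp (g := E.space) e⟩
  have block : ∀ i, ∃ φ : D.space i ≃ₗ[K] E.space (e i), ∀ (u : V) (hu : u ∈ D.space i)
      (hRu : R u ∈ D.space i), (φ ⟨R u, hRu⟩ : W) = S (φ ⟨u, hu⟩) := by
    intro i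
    obtain ⟨v, hv, hfv⟩ := D.exists_generator i
    obtain ⟨w, hw, hgw⟩ := E.exists_generator (e i)
    have hvU : v ∈ D.space i := hv ▸ ⟨1, by simp⟩
    -- Exact divisibility turns the annihilator `f ^ t` of `v` under `T` into `g ^ t` under `R`.
    have hRv : ∀ q, aeval R q v = 0 ↔ (E.poly (e i)).1 ^ D.exp i ∣ q := fun q => by
      rw [hR, ← aeval_comp_apply, hfv,
        pow_dvd_comp_iff (D.poly i).2.1 (E.poly (e i)).2.1 (hp i).1 (hp i).2]
    -- Since `deg f = deg g`, the `R`-orbit of `v` has the full dimension of the summand.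
    have hrange : LinearMap.range (orbitMap R v) = D.space i := by
      refine Submodule.eq_of_le_of_finrank_eq ?_ ?_
      · rintro _ ⟨q, rfl⟩
        rw [orbitMap_apply, hR, ← aeval_comp_apply]
        exact (D.invariant i).aeval_mem _ hvU
      · rw [finrank_range_orbitMap hRv, D.finrank_space, natDegree_pow,
          natDegree_eq_of_polyEquiv (D.poly i).2.1 (E.poly (e i)).2.1 (hpoly i)]
    obtain ⟨φ, hφ⟩ := exists_orbit_equiv (T := R) (S := S) (v := v) (w := w)
      fun q => by rw [hRv, hgw, hexp i]
    rw [← hrange, ← hw]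
    refine ⟨φ, ?_⟩
    rintro _ ⟨q, rfl⟩ hRu
    have e1 : ∀ (Z : Module.End K V) (x : V), Z (aeval Z q x) = aeval Z (X * q) x :=
      fun Z x => by rw [aeval_mul_apply, aeval_X]
    have e2 : S (aeval S q w) = aeval S (X * q) w := by rw [aeval_mul_apply, aeval_X]
    simp only [orbitMap_apply, e1] at hRu ⊢
    rw [hφ, hφ, e2]
  choose φ hφ using block
  obtain ⟨Φ, hΦ⟩ := exists_equiv_of_isInternal D.internal hE φ
  refine ⟨p, Φ, fun x => ?_⟩
  have hle : ⨆ i, D.space i ≤ LinearMap.eqLocus (Φ.toLinearMap ∘ₗ R) (S ∘ₗ Φ.toLinearMap) := by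
    refine iSup_le fun i u hu => ?_
    have hRu : R u ∈ D.space i := (D.invariant i).aeval_mem p hu
    change Φ (R u) = S (Φ u)
    rw [hΦ i ⟨R u, hRu⟩, hΦ i ⟨u, hu⟩]
    exact hφ i u hu hRu
  rw [D.internal.submodule_iSup_eq_top] at hle
  exact hle (Submodule.mem_top (x := x))

/-- If conjugation embeds each of two centralizers in the other, it identifies them. -/
theorem commute_conj_iff {T : Module.End K V} {S : Module.End K W} {Φ : V ≃ₗ[K] W}
    {Ψ : W ≃ₗ[K] V} (h : ∀ Z, Commute Z T → Commute (Φ.conj Z) S)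
    (h' : ∀ Z, Commute Z S → Commute (Ψ.conj Z) T) (Z : Module.End K V) :
    Commute Z T ↔ Commute (Φ.conj Z) S := by
  let A := Subalgebra.toSubmodule (Subalgebra.centralizer K {T})
  let B := Subalgebra.toSubmodule (Subalgebra.centralizer K {S})
  have hA : ∀ Z, Z ∈ A ↔ Commute Z T := fun Z => by
    simp [A, Subalgebra.mem_centralizer_iff, Commute, SemiconjBy, eq_comm]
  have hB : ∀ Z, Z ∈ B ↔ Commute Z S := fun Z => by
    simp [B, Subalgebra.mem_centralizer_iff, Commute, SemiconjBy, eq_comm]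
  have h1 : A.map Φ.conj.toLinearMap ≤ B := by
    rintro _ ⟨Z, hZ, rfl⟩
    exact (hB _).2 (h Z ((hA Z).1 hZ))
  have h2 : B.map Ψ.conj.toLinearMap ≤ A := by
    rintro _ ⟨Z, hZ, rfl⟩
    exact (hA _).2 (h' Z ((hB Z).1 hZ))
  -- The two embeddings force equal dimensions, so the first is onto; `Ψ` need not be inverse to
  -- `Φ`.
  have h3 : A.map Φ.conj.toLinearMap = B := by
    refine Submodule.eq_of_le_of_finrank_le h1 ?_
    have := Submodule.finrank_mono h2
    rw [LinearEquiv.finrank_map_eq] at this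
    rwa [LinearEquiv.finrank_map_eq]
  refine ⟨h Z, fun hZ => ?_⟩
  rw [← hB, ← h3] at hZ
  obtain ⟨Z', hZ', e⟩ := hZ
  rw [← Φ.conj.injective e]
  exact (hA _).1 hZ'

end SameType

/-! ### Translation between generalized types and matchings of summands. -/

section GeneralizedType

variable {K : Type u} [Field K] {n : ℕ}

theorem partitionInvariant_eq_parts (X : Matrix (Fin n) (Fin n) K) (f : MonicIrred K) :
    partitionInvariant X f = (decomp X).parts f := rfl

theorem mem_support_iff (X : Matrix (Fin n) (Fin n) K) (f : MonicIrred K) :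
    f ∈ (support_finite X).toFinset ↔ ∃ i, (decomp X).poly i = f := by
  rw [Set.Finite.mem_toFinset, ← IndecDecomp.parts_ne_zero_iff, ← partitionInvariant_eq_parts]
  rfl

/-- Corresponding fibres have equal cardinality, so bijections between them glue. -/
theorem exists_equiv_of_map_univ_eq {α β γ : Type*} [Fintype α] [Fintype β] {a : α → γ}
    {b : β → γ} (h : Finset.univ.val.map a = Finset.univ.val.map b) :
    ∃ e : α ≃ β, ∀ x, b (e x) = a x := by
  classical
  have hc : ∀ c, Nonempty ({x // a x = c} ≃ {y // b y = c}) := fun c => by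
    have := congrArg (Multiset.count c) h
    rw [Multiset.count_map, Multiset.count_map] at this
    refine ⟨Fintype.equivOfCardEq ?_⟩
    rw [Fintype.card_subtype, Fintype.card_subtype]
    simpa only [eq_comm (a := c), ← Finset.filter_val, Finset.card_val] using this
  exact ⟨Equiv.ofFiberEquiv fun c => (hc c).some, fun x => Equiv.ofFiberEquiv_map _ x⟩

/-- Matrices of the same generalized type have matching decompositions. -/
theorem exists_matching {X Y : Matrix (Fin n) (Fin n) K}
    (h : generalizedType X = generalizedType Y) :
    ∃ e : Fin (decomp X).size ≃ Fin (decomp Y).size,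
      (∀ i, PolyEquiv ((decomp X).poly i).1 ((decomp Y).poly (e i)).1) ∧
      (∀ i, (decomp X).exp i = (decomp Y).exp (e i)) ∧
      ∀ i j, (decomp X).poly i = (decomp X).poly j →
        (decomp Y).poly (e i) = (decomp Y).poly (e j) := by
  classical
  let A := (support_finite X).toFinset
  let B := (support_finite Y).toFinset
  -- The matching has two levels: `σ` pairs the polynomials, then `e` pairs the summands by
  -- polynomial and exponent.
  obtain ⟨σ, hσ⟩ := exists_equiv_of_map_univ_eq
    (a := fun f : A => (Quotient.mk (irredSetoid K) f.1, partitionInvariant X f.1))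
    (b := fun g : B => (Quotient.mk (irredSetoid K) g.1, partitionInvariant Y g.1)) (by
      have e1 : ∀ (s : Finset (MonicIrred K)) {γ : Type u} (F : MonicIrred K → γ),
          (Finset.univ : Finset s).val.map (fun f => F f.1) = s.val.map F := fun s γ F => by
        rw [Finset.univ_eq_attach, Finset.attach_val]
        exact Multiset.attach_map_val' s.val F
      rw [e1 A (fun f => (Quotient.mk (irredSetoid K) f, partitionInvariant X f)),
        e1 B (fun f => (Quotient.mk (irredSetoid K) f, partitionInvariant Y f))]
      exact h)
  let a : Fin (decomp X).size → A := fun i => ⟨_, (mem_support_iff X _).2 ⟨i, rfl⟩⟩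
  let b : Fin (decomp Y).size → B := fun i => ⟨_, (mem_support_iff Y _).2 ⟨i, rfl⟩⟩
  obtain ⟨e, he⟩ := exists_equiv_of_map_univ_eq
    (a := fun i => (σ (a i), (decomp X).exp i)) (b := fun i => (b i, (decomp Y).exp i)) (by
      ext ⟨g, t⟩
      obtain ⟨f, rfl⟩ := σ.surjective g
      -- The summands with polynomial `f` and exponent `t` are counted by the multiplicity of `t` in
      -- the partition of `f`.
      have h2 := congrArg (Multiset.count t) (congrArg Prod.snd (hσ f))
      simp only [partitionInvariant, Multiset.count_map, ← Finset.filter_val, Finset.card_val,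
        Finset.filter_filter] at h2
      rw [Multiset.count_map, Multiset.count_map, ← Finset.filter_val, ← Finset.filter_val,
        Finset.card_val, Finset.card_val]
      convert h2.symm using 4
      · rw [Prod.mk.injEq, σ.injective.eq_iff, Subtype.ext_iff, eq_comm (a := f.1)]
      · rw [Prod.mk.injEq, Subtype.ext_iff, eq_comm (a := (σ f).1)])
  have he1 : ∀ i, b (e i) = σ (a i) := fun i => congrArg Prod.fst (he i)
  refine ⟨e, fun i => ?_, fun i => (congrArg Prod.snd (he i)).symm, fun i j hij => ?_⟩
  · have h1 : Quotient.mk (irredSetoid K) (σ (a i)).1 = Quotient.mk (irredSetoid K) (a i).1 :=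
      congrArg Prod.fst (hσ (a i))
    rw [← he1] at h1
    exact Quotient.exact h1.symm
  · have h1 : a i = a j := Subtype.ext hij
    have h2 : b (e i) = b (e j) := by rw [he1, he1, h1]
    exact congrArg Subtype.val h2

theorem IndecDecomp.parts_of_matching {V W : Type*} [AddCommGroup V] [Module K V]
    [AddCommGroup W] [Module K W] {T : Module.End K V} {S : Module.End K W}
    {D : IndecDecomp T} {E : IndecDecomp S} (e : Fin D.size ≃ Fin E.size)
    (hexp : ∀ i, D.exp i = E.exp (e i))
    (heq : ∀ i j, D.poly i = D.poly j ↔ E.poly (e i) = E.poly (e j)) (i : Fin D.size) :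
    D.parts (D.poly i) = E.parts (E.poly (e i)) := by
  classical
  have h : (Finset.univ.filter fun j => E.poly j = E.poly (e i)) =
      (Finset.univ.filter fun j => D.poly j = D.poly i).map e.toEmbedding := by
    ext j
    obtain ⟨j, rfl⟩ := e.surjective j
    simp [heq]
  rw [IndecDecomp.parts, IndecDecomp.parts]
  convert (congrArg (fun s : Finset (Fin E.size) => s.val.map E.exp) h).symm using 1
  rw [Finset.map_val, Multiset.map_map]
  exact Multiset.map_congr rfl fun j _ => hexp j

/-- `E` need not come from `decomp Y`: its parts agree with those of `decomp Y` by `parts_eq`, since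
`S` is similar to the action of `Y`. -/
theorem generalizedType_eq_of_matching {V : Type*} [AddCommGroup V] [Module K V]
    [FiniteDimensional K V] {X Y : Matrix (Fin n) (Fin n) K} {S : Module.End K V}
    (E : IndecDecomp S) (Φ : V ≃ₗ[K] (Fin n → K))
    (hΦ : ∀ x, Φ (S x) = Y.vecMulLinear (Φ x)) (e : Fin (decomp X).size ≃ Fin E.size)
    (hpoly : ∀ i, PolyEquiv ((decomp X).poly i).1 (E.poly (e i)).1)
    (hexp : ∀ i, (decomp X).exp i = E.exp (e i))
    (heq : ∀ i j, (decomp X).poly i = (decomp X).poly j ↔ E.poly (e i) = E.poly (e j)) :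
    generalizedType X = generalizedType Y := by
  have hY : ∀ g, g ∈ (support_finite Y).toFinset ↔ ∃ j, E.poly j = g := fun g => by
    rw [mem_support_iff, ← IndecDecomp.parts_ne_zero_iff, ← IndecDecomp.parts_ne_zero_iff,
      E.parts_eq (decomp Y) Φ hΦ]
  choose r hr using fun f (hf : f ∈ (support_finite X).toFinset) => (mem_support_iff X f).1 hf
  refine Multiset.map_eq_map_of_bij_of_nodup _ _ (Finset.nodup _) (Finset.nodup _)
    (fun f hf => E.poly (e (r f hf))) (fun f hf => (hY _).2 ⟨_, rfl⟩) ?_ ?_ ?_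
  · intro f hf g hg hfg
    rw [← heq, hr, hr] at hfg
    exact hfg
  · intro g hg
    obtain ⟨j, rfl⟩ := (hY g).1 hg
    have hf : (decomp X).poly (e.symm j) ∈ (support_finite X).toFinset :=
      (mem_support_iff X _).2 ⟨_, rfl⟩
    exact ⟨_, hf, by rw [(heq _ (e.symm j)).1 (hr _ hf), e.apply_symm_apply]⟩
  · intro f hf
    have h1 := hpoly (r f hf)
    have h2 := IndecDecomp.parts_of_matching e hexp heq (r f hf)
    rw [hr f hf] at h1 h2
    refine Prod.ext (Quotient.sound h1) ?_
    rw [partitionInvariant_eq_parts, partitionInvariant_eq_parts, h2]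
    exact E.parts_eq (decomp Y) Φ hΦ _

/-- The row actions of two matrices have conjugate centralizers just when their generalized types agree. -/
theorem exists_conj_iff_generalizedType_eq (X Y : Matrix (Fin n) (Fin n) K) :
    (∃ Φ : (Fin n → K) ≃ₗ[K] (Fin n → K), ∀ Z : Module.End K (Fin n → K),
      Commute Z X.vecMulLinear ↔ Commute (Φ.conj Z) Y.vecMulLinear) ↔
      generalizedType X = generalizedType Y := by
  constructor
  · rintro ⟨Φ, hΦ⟩
    set T : Module.End K (Fin n → K) := X.vecMulLinear
    -- Pulling the action of `Y` back along `Φ` makes the centralizers equal rather than merely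
    -- conjugate.
    set S : Module.End K (Fin n → K) := Φ.symm.conj Y.vecMulLinear with hS
    have hΦS : ∀ x, Φ (S x) = Y.vecMulLinear (Φ x) := fun x => by
      rw [hS, LinearEquiv.conj_apply_apply, LinearEquiv.symm_symm, LinearEquiv.apply_symm_apply]
    have hC : ∀ Z, Commute Z T ↔ Commute Z S := fun Z => by
      rw [hΦ Z, hS]
      constructor
      · intro h
        have h' := h.map (Φ.symm.conjRingEquiv)
        have e1 : Φ.symm.conjRingEquiv (Φ.conj Z) = Z := by
          ext x; simp [LinearEquiv.conjRingEquiv]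
        rw [e1] at h'
        exact h'
      · intro h
        have h' := h.map (Φ.conjRingEquiv)
        have e1 : Φ.conjRingEquiv (Φ.symm.conj Y.vecMulLinear) = Y.vecMulLinear := by
          ext x; simp [LinearEquiv.conjRingEquiv]
        rw [e1] at h'
        exact h'
    have hTS : Commute T S := (hC T).1 (Commute.refl T)
    obtain ⟨E, e, he⟩ := (decomp X).exists_same_space hC
    have hm := fun i => (decomp X).polyEquiv_and_exp_eq E hTS (he i)
    refine generalizedType_eq_of_matching E Φ hΦS e (fun i => (hm i).1) (fun i => (hm i).2)
      fun i j => ⟨fun h => (decomp X).poly_eq_of_poly_eq E (fun Z => (hC Z).1) (he i) (he j) h,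
        fun h => E.poly_eq_of_poly_eq (decomp X) (fun Z => (hC Z).2) (he i).symm (he j).symm h⟩
  · intro h
    have key : ∀ {X Y : Matrix (Fin n) (Fin n) K}, generalizedType X = generalizedType Y →
        ∃ Φ : (Fin n → K) ≃ₗ[K] (Fin n → K), ∀ Z : Module.End K (Fin n → K),
          Commute Z X.vecMulLinear → Commute (Φ.conj Z) Y.vecMulLinear := by
      intro X Y h
      obtain ⟨e, h1, h2, h3⟩ := exists_matching h
      obtain ⟨p, Φ, hΦ⟩ := (decomp X).exists_aeval_conj (decomp Y) e h1 h2 h3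
      exact ⟨Φ, fun Z hZ => commute_conj_of_aeval hΦ hZ⟩
    obtain ⟨Φ, hΦ⟩ := key h
    obtain ⟨Ψ, hΨ⟩ := key h.symm
    exact ⟨Φ, commute_conj_iff hΦ hΨ⟩

end GeneralizedType

/-! ### Passage between matrices and their action on row vectors. -/

section MatrixCentralizer

variable {K : Type u} [Field K] {n : ℕ}

theorem vecMulLinear_bijective :
    Function.Bijective (fun Z : Matrix (Fin n) (Fin n) K => Z.vecMulLinear) :=
  LinearMap.toMatrixRight'.symm.bijective

/-- The row action reverses products, which is harmless for commutation. -/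
theorem commute_vecMulLinear_iff (Z X : Matrix (Fin n) (Fin n) K) :
    Commute (S := Module.End K (Fin n → K)) Z.vecMulLinear X.vecMulLinear ↔
      Z ∈ Subalgebra.centralizer K {X} := by
  have hmul : ∀ A B : Matrix (Fin n) (Fin n) K,
      (A.vecMulLinear * B.vecMulLinear : Module.End K (Fin n → K)) = (B * A).vecMulLinear :=
    fun A B => (Matrix.toLinearMapRight'_mul B A).symm
  rw [Subalgebra.mem_centralizer_iff, commute_iff_eq, hmul, hmul,
    vecMulLinear_bijective.injective.eq_iff]
  simp

/-- The automorphism `v ↦ v P⁻¹` of the space of row vectors. -/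
def rowEquiv (P : Matrix.GeneralLinearGroup (Fin n) K) : (Fin n → K) ≃ₗ[K] (Fin n → K) :=
  Matrix.toLinearEquivRight'OfInv (M := P.1) (M' := P⁻¹.1) P.mul_inv P.inv_mul

/-- Because products are reversed, it is `v ↦ v P⁻¹`, not `v ↦ v P`, that induces `Z ↦ P Z P⁻¹`. -/
theorem conj_rowEquiv (P : Matrix.GeneralLinearGroup (Fin n) K) (Z : Matrix (Fin n) (Fin n) K) :
    (rowEquiv P).conj Z.vecMulLinear = (P.1 * Z * P⁻¹.1).vecMulLinear := by
  refine LinearMap.ext fun v => ?_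
  rw [LinearEquiv.conj_apply_apply, Matrix.vecMulLinear_apply, Matrix.vecMulLinear_apply,
    ← Matrix.vecMul_vecMul, ← Matrix.vecMul_vecMul]
  rfl

theorem exists_rowEquiv_eq (Φ : (Fin n → K) ≃ₗ[K] (Fin n → K)) :
    ∃ P : Matrix.GeneralLinearGroup (Fin n) K, rowEquiv P = Φ := by
  obtain ⟨Q, hQ⟩ := vecMulLinear_bijective.surjective Φ.toLinearMap
  obtain ⟨P, hP⟩ := vecMulLinear_bijective.surjective Φ.symm.toLinearMap
  have hQ' : ∀ v, Matrix.vecMul v Q = Φ v := fun v => LinearMap.congr_fun hQ v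
  have hP' : ∀ v, Matrix.vecMul v P = Φ.symm v := fun v => LinearMap.congr_fun hP v
  have h1 : P * Q = 1 := vecMulLinear_bijective.injective <| LinearMap.ext fun v => by
    simp [← Matrix.vecMul_vecMul, hP', hQ']
  have h2 : Q * P = 1 := vecMulLinear_bijective.injective <| LinearMap.ext fun v => by
    simp [← Matrix.vecMul_vecMul, hP', hQ']
  exact ⟨⟨P, Q, h1, h2⟩, LinearEquiv.ext hQ'⟩

theorem image_centralizer_eq_iff (X Y : Matrix (Fin n) (Fin n) K)
    (P : Matrix.GeneralLinearGroup (Fin n) K) :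
    (fun Z : Matrix (Fin n) (Fin n) K => P.1 * Z * P⁻¹.1) ''
        (Subalgebra.centralizer K {X} : Set (Matrix (Fin n) (Fin n) K)) =
        (Subalgebra.centralizer K {Y} : Set (Matrix (Fin n) (Fin n) K)) ↔
      ∀ Z : Module.End K (Fin n → K),
        Commute Z X.vecMulLinear ↔ Commute ((rowEquiv P).conj Z) Y.vecMulLinear := by
  have h1 : ∀ Z, P⁻¹.1 * (P.1 * Z * P⁻¹.1) * P.1 = Z := fun Z => by
    rw [mul_assoc, mul_assoc, Units.inv_mul, mul_one, ← mul_assoc, Units.inv_mul, one_mul]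
  have h2 : ∀ Z, P.1 * (P⁻¹.1 * Z * P.1) * P⁻¹.1 = Z := fun Z => by
    rw [mul_assoc, mul_assoc, Units.mul_inv, mul_one, ← mul_assoc, Units.mul_inv, one_mul]
  rw [vecMulLinear_bijective.surjective.forall]
  simp only [conj_rowEquiv, commute_vecMulLinear_iff]
  constructor
  · intro h Z
    rw [← SetLike.mem_coe (x := P.1 * Z * P⁻¹.1), ← h]
    refine ⟨fun hZ => ⟨Z, hZ, rfl⟩, ?_⟩
    rintro ⟨Z', hZ', e⟩
    have e' : P.1 * Z' * P⁻¹.1 = P.1 * Z * P⁻¹.1 := e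
    rw [← h1 Z, ← e', h1]
    exact hZ'
  · intro h
    ext Z
    constructor
    · rintro ⟨Z', hZ', rfl⟩
      exact (h Z').1 hZ'
    · intro hZ
      exact ⟨P⁻¹.1 * Z * P.1, (h _).2 (by rw [h2]; exact hZ), h2 Z⟩

end MatrixCentralizer

end GenType

end

theorem theorem1p1 {K : Type*} [Field K] {n : ℕ} (X Y : Matrix (Fin n) (Fin n) K) :
    (∃ P : Matrix.GeneralLinearGroup (Fin n) K,
      (fun Z : Matrix (Fin n) (Fin n) K =>
          (P : Matrix (Fin n) (Fin n) K) * Z *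
            ((P⁻¹ : Matrix.GeneralLinearGroup (Fin n) K) : Matrix (Fin n) (Fin n) K)) ''
        (Subalgebra.centralizer K {X} : Set (Matrix (Fin n) (Fin n) K)) =
        (Subalgebra.centralizer K {Y} : Set (Matrix (Fin n) (Fin n) K))) ↔
      GenType.generalizedType X = GenType.generalizedType Y := by
  rw [← GenType.exists_conj_iff_generalizedType_eq]
  constructor
  · rintro ⟨P, hP⟩
    exact ⟨GenType.rowEquiv P, (GenType.image_centralizer_eq_iff X Y P).1 hP⟩
  · rintro ⟨Φ, hΦ⟩
    obtain ⟨P, rfl⟩ := GenType.exists_rowEquiv_eq Φ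
    exact ⟨P, (GenType.image_centralizer_eq_iff X Y P).2 hΦ⟩
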